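/- Let $P[x]\subset\mathbb Z[x]$ be the semiring consisting of $0$ and the polynomials with positive leading coefficient, and let $(k,\sigma)$ be a difference field of characteristic $0$. An affine $P[x]$-semimodule is a finitely generated $P[x]$-submodule $S\subseteq\mathbb Z[x]^n$; $S^{md}$ is the $\mathbb Z[x]$-submodule it generates. A face of $S$ is a $P[x]$-subsemimodule $F\ni 0$ of $S$ such that for $u,v\in S$ and $0\neq g\in P[x]$, $u+v\in F$ implies $u,v\in F$, and $gu\in F$ implies $u\in F$. A fan $\Sigma=\{S_i\}_{i\in I}$ is a finite non-empty family of affine $P[x]$-semimodules in $\mathbb Z[x]^n$ such that (a) all $S_i^{md}$ are equal to one lattice $M=\Sigma^{md}$; (b) for $i\ne j$ there is $u\in S_i$ with $-u\in S_j$ and $S_i+\mathbb Z[x](-u)=S_j+\mathbb Z[x]u$ (we say that $u$ separates $(S_i,S_j)$); (c) for distinct $i,j,l$ and $u,v,w$ separating $(S_i,S_j)$, $(S_j,S_l)$, $(S_l,S_i)$, one has $S_i+\mathbb Z[x](-u)+\mathbb Z[x]w=S_j+\mathbb Z[x]u+\mathbb Z[x](-v)=S_l+\mathbb Z[x]v+\mathbb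 Z[x](-w)$. The algebra $k[S]=\bigoplus_{u\in S}k\chi^u$ carries $\sigma(\sum c_u\chi^u)=\sum\sigma(c_u)\chi^{xu}$. $\operatorname{Spec}^{P[\sigma]}(k[S])$ is the set of its $P[\sigma]$-prime ideals, i.e. prime $\sigma$-ideals $I$ that are perfect ($\prod_m\sigma^m(f)^{c_m}\in I$ with $c_m\in\mathbb N$ not all $0$ implies $f\in I$) and satisfy $\chi^uf\in I\Rightarrow\chi^{gu}f\in I$ for $0\ne g\in P[x]$; its closed sets are the sets $\{\mathfrak p\mid A\subseteq\mathfrak p\}$ with $A\subseteq k[S]$. For a difference field extension $K$ of $k$, its $K$-points are the maps $\gamma:S\to K$ with $\gamma(\sum g_iu_i)=\prod\gamma(u_i)^{g_i}$, where $a^g=\prod_j\sigma^j(a)^{c_j}$ for $g=\sum c_jx^j$ (and $0^g=0$ for $g\neq0$, $0^0=1$). The toric $P[\sigma]$-variety $X_\Sigma$ is glued from the $X_i=\operatorname{Spec}^{P[\sigma]}(k[S_i])$ along the open subsets $\operatorname{Spec}^{P[\sigma]}(k[S_i+\mathbb Z[x](-u)])=\operatorname{Spec}^{P[\sigma]}(k[S_j+\mathbb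 Z[x]u])$ for $u$ separating $(S_i,S_j)$, both as a topological space and on $K$-points. Its $P[\sigma]$-subvarieties are its closed subsets. The torus $T_\Sigma=\operatorname{Spec}^{P[\sigma]}(k[M])$ acts by $(t\gamma)(u)=t(u)\gamma(u)$, and a subvariety $Y$ is $T_\Sigma$-invariant if $T_\Sigma(K)\cdot Y(K)\subseteq Y(K)$ for all $K$. On the pairs $(i,F)$, $F$ a face of $S_i$, put $(i,F)\sim(j,F')$ if, for some $u$ that separates $(S_i,S_j)$ (where $i=j$ is allowed), there is a face $H$ of $S_i+\mathbb Z[x](-u)$ with $F^{md}=F'^{md}=H^{md}$. Let $L_\Sigma$ be the set of equivalence classes. **Theorem.** Let $\Sigma=\{S_i\}_{i\in I}$ be a fan. For $L\in L_\Sigma$ let $D(L)\subseteq X_\Sigma$ be the union, over all $(i,F)\in L$, of the subvarieties of $X_i$ defined by the ideals $k[S_i\setminus F]=\bigoplus_{u\in S_i\setminus F}k\chi^u$. Then $L\mapsto D(L)$ is a bijection from $L_\Sigma$ onto the set of irreducible $T_\Sigma$-invariant $P[\sigma]$-subvarieties of $X_\Sigma$. Moreover, for every $L\in L_\Sigma$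 the family $\{F\}_{(i,F)\in L}$ is a fan, and $D(L)$ is isomorphic, as a $P[\sigma]$-variety, to the toric $P[\sigma]$-variety $X_L$ of this fan. Here an isomorphism is a homeomorphism together with a compatible bijection of $K$-points, natural in $K$, both given in each direction, locally on the open sets $\chi^b\ne0$ of the charts, by $P[\sigma]$-terms $c\,\chi^{s}/\chi^{gb}$ with $c\in k$, $s$ and $b$ in the semimodule of the chart and $g\in P[x]$. -/

import Mathlib

open Polynomial

universe u v w

namespace PDiff

noncomputable section

/-! ### The semiring `P[x]` and affine `P[x]`-semimodules -/

/-- `P[x] = {f ∈ ℤ[x] | f = 0 or lc(f) > 0}`, the non-negative part of `ℤ[x]` for the total order in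
which `f > g` iff the leading coefficient of `f - g` is positive. -/
def PX : Subsemiring ℤ[X] where
  carrier := {f | 0 ≤ f.leadingCoeff}
  zero_mem' := by simp
  one_mem' := by simp
  mul_mem' {f g} hf hg := by
    simp only [Set.mem_ofPred_eq, leadingCoeff_mul] at *
    exact mul_nonneg hf hg
  add_mem' {f g} hf hg := by
    simp only [Set.mem_ofPred_eq] at *
    by_cases hf0 : f = 0
    · simpa [hf0] using hg
    by_cases hg0 : g = 0
    · simpa [hg0] using hf
    rcases lt_trichotomy f.degree g.degree with h | h | h
    · rw [leadingCoeff_add_of_degree_lt h]; exact hg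
    · have hf' : 0 < f.leadingCoeff := lt_of_le_of_ne hf (Ne.symm (leadingCoeff_ne_zero.2 hf0))
      have hg' : 0 < g.leadingCoeff := lt_of_le_of_ne hg (Ne.symm (leadingCoeff_ne_zero.2 hg0))
      rw [leadingCoeff_add_of_degree_eq h (by omega)]
      exact add_nonneg hf hg
    · rw [leadingCoeff_add_of_degree_lt' h]; exact hf

/-- The element `x` of `P[x]`. -/
def xP : PX := ⟨X, show 0 ≤ (X : ℤ[X]).leadingCoeff by simp⟩

/-- `P[x]`-semimodules `S ⊆ ℤ[x]ⁿ`. Such an `S` is affine iff `S.FG`. -/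
abbrev Semimod (n : ℕ) : Type := Submodule PX (Fin n → ℤ[X])

/-- The `ℤ[x]`-lattice `S^md` generated by `S`. -/
def md {n : ℕ} (S : Semimod n) : Submodule ℤ[X] (Fin n → ℤ[X]) :=
  Submodule.span ℤ[X] (S : Set (Fin n → ℤ[X]))

/-- `S + ℤ[x]·a`. -/
def adjoin {n : ℕ} (S : Semimod n) (a : Fin n → ℤ[X]) : Semimod n :=
  S ⊔ (Submodule.span ℤ[X] {a}).restrictScalars PX

/-- `F` is a face of `S`. -/
structure IsFace {n : ℕ} (S F : Semimod n) : Prop where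
  le : F ≤ S
  of_add : ∀ a ∈ S, ∀ b ∈ S, a + b ∈ F → a ∈ F ∧ b ∈ F
  of_smul : ∀ g : PX, g ≠ 0 → ∀ a ∈ S, g • a ∈ F → a ∈ F

/-! ### Fans -/

/-- `a ∈ S`, `-a ∈ S'` and `S + ℤ[x](-a) = S' + ℤ[x](a)`. -/
structure Separates {n : ℕ} (S S' : Semimod n) (a : Fin n → ℤ[X]) : Prop where
  mem : a ∈ S
  neg_mem : -a ∈ S'
  eq : adjoin S (-a) = adjoin S' a

/-- A finite (non-empty) family of affine `P[x]`-semimodules in `ℤ[x]ⁿ` is a fan if it is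
compatible. -/
structure IsFan {n : ℕ} {ι : Type v} (S : ι → Semimod n) : Prop where
  finite : Finite ι
  nonempty : Nonempty ι
  affine : ∀ i, (S i).FG
  md_eq : ∃ M : Submodule ℤ[X] (Fin n → ℤ[X]), ∀ i, md (S i) = M
  pair : ∀ i j, i ≠ j → ∃ a, Separates (S i) (S j) a
  triple : ∀ i j l, i ≠ j → j ≠ l → l ≠ i → ∀ a b c,
    Separates (S i) (S j) a → Separates (S j) (S l) b → Separates (S l) (S i) c →
      adjoin (adjoin (S i) (-a)) c = adjoin (adjoin (S j) a) (-b) ∧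
      adjoin (adjoin (S j) a) (-b) = adjoin (adjoin (S l) b) (-c)

/-- The faces of the members of a family: pairs `(i, F)` with `F` a face of `S i`. -/
abbrev FaceOf {n : ℕ} {ι : Type v} (S : ι → Semimod n) : Type v :=
  Σ i, {F : Semimod n // IsFace (S i) F}

/-- For `F` a face of `S i`, `F'` a face of `S j` and `S i + ℤ[x](-a) = S j + ℤ[x](a)`:
`F ∼ F'` iff there is a face `H` of `S i + ℤ[x](-a)` such that `F^md = F'^md = H^md`. -/
def FaceRel {n : ℕ} {ι : Type v} (S : ι → Semimod n) (A B : FaceOf S) : Prop :=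
  ∃ a, Separates (S A.1) (S B.1) a ∧ ∃ H : Semimod n, IsFace (adjoin (S A.1) (-a)) H ∧
    md A.2.1 = md H ∧ md B.2.1 = md H

/-- The set `L_Σ` of equivalence classes of faces (for a fan, `FaceRel` is an equivalence
relation). -/
def FaceClass {n : ℕ} {ι : Type v} (S : ι → Semimod n) : Type v := Quot (FaceRel S)

/-- The class of a face. -/
def FaceOf.cls {n : ℕ} {ι : Type v} {S : ι → Semimod n} (A : FaceOf S) : FaceClass S :=
  Quot.mk _ A

/-- An element `L` of `L_Σ`, seen as the family of its members. -/
def FaceClass.family {n : ℕ} {ι : Type v} {S : ι → Semimod n} (L : FaceClass S) :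
    {A : FaceOf S // A.cls = L} → Semimod n :=
  fun A => A.1.2.1

/-! ### The algebra `k[S]` and its `P[σ]`-spectrum -/

section Algebra

variable {k : Type u} [Field k] (σ : k →+* k) {n : ℕ}

/-- The monomial `χ^a` of `k[S]`. -/
def chi (k : Type u) [Field k] {n : ℕ} {S : Semimod n} (a : S) :
    AddMonoidAlgebra k S :=
  AddMonoidAlgebra.single a 1

/-- The difference operator of `k[S]`: `σ(∑ c_a χ^a) = ∑ σ(c_a) χ^(x a)`. -/
def sig (S : Semimod n) : AddMonoidAlgebra k S →+* AddMonoidAlgebra k S :=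
  (AddMonoidAlgebra.mapRingHom S σ).comp
    (AddMonoidAlgebra.mapDomainRingHom k (DistribSMul.toAddMonoidHom S xP))

/-- The inclusion `k[S] ⊆ k[S']` for `S ⊆ S'`. -/
def incl (k : Type u) [Field k] {S S' : Semimod n} (h : S ≤ S') :
    AddMonoidAlgebra k S →+* AddMonoidAlgebra k S' :=
  AddMonoidAlgebra.mapDomainRingHom k (Submodule.inclusion h).toAddMonoidHom

/-- `P[σ]`-prime ideals of `k[S]`: prime ideals that are `σ`-ideals, perfect, and such that
`χ^a f ∈ I` implies `χ^(g a) f ∈ I` for every non-zero `g ∈ P[x]`. -/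
structure IsPPrime {S : Semimod n} (I : Ideal (AddMonoidAlgebra k S)) : Prop where
  prime : I.IsPrime
  sigma : ∀ f ∈ I, sig σ S f ∈ I
  perfect : ∀ (f : AddMonoidAlgebra k S) (g : ℕ[X]), g ≠ 0 →
    (∏ m ∈ g.support, ((sig σ S)^[m] f) ^ g.coeff m) ∈ I → f ∈ I
  monomial : ∀ (a : S) (f : AddMonoidAlgebra k S), chi k a * f ∈ I →
    ∀ g : PX, g ≠ 0 → chi k (g • a) * f ∈ I

/-- `Spec^{P[σ]}(k[S])`, the set of `P[σ]`-prime ideals of `k[S]`. -/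
structure PSpec (S : Semimod n) where
  ideal : Ideal (AddMonoidAlgebra k S)
  isPPrime : IsPPrime σ ideal

/-- The topology of `Spec^{P[σ]}(k[S])`: the closed sets are the sets
`{p | F ⊆ p}`, `F ⊆ k[S]`. -/
instance (S : Semimod n) : TopologicalSpace (PSpec σ S) :=
  TopologicalSpace.induced
    (fun p => (⟨p.ideal, p.isPPrime.prime⟩ : PrimeSpectrum (AddMonoidAlgebra k S)))
    PrimeSpectrum.zariskiTopology

lemma incl_chi {S S' : Semimod n} (h : S ≤ S') (a : S) :
    incl k h (chi k a) = chi k (Submodule.inclusion h a) := by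
  simp [incl, chi]

lemma incl_sig {S S' : Semimod n} (h : S ≤ S') (f : AddMonoidAlgebra k S) :
    incl k h (sig σ S f) = sig σ S' (incl k h f) := by
  suffices H : (incl k h).comp (sig σ S) = (sig σ S').comp (incl k h) from
    RingHom.congr_fun H f
  ext <;> simp [incl, sig, AddMonoidAlgebra.mapRingHom_single]

lemma incl_sig_iter {S S' : Semimod n} (h : S ≤ S') (m : ℕ) (f : AddMonoidAlgebra k S) :
    incl k h ((sig σ S)^[m] f) = (sig σ S')^[m] (incl k h f) := by
  induction m generalizing f with
  | zero => rfl
  | succ m ih => rw [Function.iterate_succ_apply, Function.iterate_succ_apply, ih, incl_sig]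

/-- The map `Spec^{P[σ]}(k[S']) → Spec^{P[σ]}(k[S])` dual to `k[S] ⊆ k[S']`. -/
def PSpec.restrict {σ : k →+* k} {S S' : Semimod n} (h : S ≤ S')
    (p : PSpec σ S') : PSpec σ S where
  ideal := p.ideal.comap (incl k h)
  isPPrime := by
    refine ⟨?_, ?_, ?_, ?_⟩
    · have := p.isPPrime.prime
      exact Ideal.IsPrime.comap _
    · intro f hf
      rw [Ideal.mem_comap] at hf ⊢
      rw [incl_sig]
      exact p.isPPrime.sigma _ hf
    · intro f g hg hf
      rw [Ideal.mem_comap] at hf ⊢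
      refine p.isPPrime.perfect _ g hg ?_
      simpa [map_prod, incl_sig_iter] using hf
    · intro a f hf g hg
      rw [Ideal.mem_comap, map_mul, incl_chi] at hf ⊢
      rw [map_smul]
      exact p.isPPrime.monomial _ _ hf g hg

end Algebra

/-! ### `σ`-field extensions and points with values in them -/

/-- A `σ`-field extension of the `σ`-field `(k, σ)`. -/
structure SigmaExt (k : Type u) [Field k] (σ : k →+* k) where
  carrier : Type u
  [field : Field carrier]
  [algebra : Algebra k carrier]
  τ : carrier →+* carrier
  comm : ∀ a, τ (algebraMap k carrier a) = algebraMap k carrier (σ a)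

attribute [instance] SigmaExt.field SigmaExt.algebra

/-- Morphisms of `σ`-field extensions of `(k, σ)`. -/
structure SigmaExt.Hom {k : Type u} [Field k] {σ : k →+* k} (K K' : SigmaExt k σ) where
  map : K.carrier →ₐ[k] K'.carrier
  comm : ∀ a, map (K.τ a) = K'.τ (map a)

/-- `a^g = ∏ σ^i(a)^(c_i)` for `g = ∑ c_i x^i`. With `0⁻¹ = 0`, this is `0` for `a = 0`, `g ≠ 0`
and `1` for `g = 0`. -/
def spow {K : Type u} [Field K] (τ : K →+* K) (a : K) (g : ℤ[X]) : K :=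
  ∏ i ∈ g.support, (τ^[i] a) ^ g.coeff i

section Points

variable {k : Type u} [Field k] {σ : k →+* k} {n : ℕ}

/-- The `K`-points of the affine toric variety `Spec^{P[σ]}(k[S])`, i.e. the morphisms `S → K`:
maps `γ` with `γ(∑ g_i a_i) = ∏ γ(a_i)^(g_i)`. -/
@[ext]
structure Pt (S : Semimod n) (K : SigmaExt k σ) where
  toFun : S → K.carrier
  map_zero' : toFun 0 = 1
  map_add' : ∀ a b, toFun (a + b) = toFun a * toFun b
  map_smul' : ∀ (g : PX) a, toFun (g • a) = spow K.τ (toFun a) g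

/-- Evaluation `k[S] → K` at a point. -/
def Pt.eval {S : Semimod n} {K : SigmaExt k σ} (γ : Pt S K) :
    AddMonoidAlgebra k S →ₐ[k] K.carrier :=
  AddMonoidAlgebra.lift k K.carrier S
    { toFun := fun a => γ.toFun a.toAdd
      map_one' := γ.map_zero'
      map_mul' := fun a b => γ.map_add' a.toAdd b.toAdd }

lemma Pt.eval_single {S : Semimod n} {K : SigmaExt k σ} (γ : Pt S K) (a : S) (c : k) :
    γ.eval (AddMonoidAlgebra.single a c) = algebraMap k K.carrier c * γ.toFun a := by
  simp [Pt.eval, AddMonoidAlgebra.lift_single, Algebra.smul_def]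

lemma spow_X {K : Type u} [Field K] (τ : K →+* K) (a : K) : spow τ a X = τ a := by
  simp [spow, support_X]

lemma spow_zero {K : Type u} [Field K] (τ : K →+* K) (g : ℤ[X]) (hg : g ≠ 0) :
    spow τ 0 g = 0 := by
  obtain ⟨i, hi⟩ := Polynomial.support_nonempty.2 hg
  refine Finset.prod_eq_zero hi ?_
  rw [iterate_map_zero, zero_zpow _ (mem_support_iff.1 hi)]

lemma Pt.eval_sig {S : Semimod n} {K : SigmaExt k σ} (γ : Pt S K) (f : AddMonoidAlgebra k S) :
    γ.eval (sig σ S f) = K.τ (γ.eval f) := by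
  suffices H : γ.eval.toRingHom.comp (sig σ S) = K.τ.comp γ.eval.toRingHom from
    RingHom.congr_fun H f
  have hx : ∀ a : S, γ.toFun (xP • a) = K.τ (γ.toFun a) := fun a => by
    rw [γ.map_smul']; exact spow_X _ _
  refine AddMonoidAlgebra.ringHom_ext (fun c => ?_) (fun a => ?_)
  · simp [sig, AddMonoidAlgebra.mapRingHom_single, Pt.eval_single, γ.map_zero', K.comm]
  · simp [sig, AddMonoidAlgebra.mapRingHom_single, Pt.eval_single, hx]

lemma Pt.eval_sig_iter {S : Semimod n} {K : SigmaExt k σ} (γ : Pt S K) (m : ℕ)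
    (f : AddMonoidAlgebra k S) : γ.eval ((sig σ S)^[m] f) = K.τ^[m] (γ.eval f) := by
  induction m generalizing f with
  | zero => rfl
  | succ m ih => rw [Function.iterate_succ_apply, Function.iterate_succ_apply, ih, γ.eval_sig]

/-- The point of the topological space `Spec^{P[σ]}(k[S])` defined by a `K`-point: the ideal of all
`f` that vanish there. -/
def Pt.toSpec {S : Semimod n} {K : SigmaExt k σ} (γ : Pt S K) : PSpec σ S where
  ideal := RingHom.ker γ.eval
  isPPrime := by
    refine ⟨RingHom.ker_isPrime _, ?_, ?_, ?_⟩
    · intro f hf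
      rw [RingHom.mem_ker] at hf ⊢
      rw [γ.eval_sig, hf, map_zero]
    · intro f g hg hf
      rw [RingHom.mem_ker] at hf ⊢
      rw [map_prod, Finset.prod_eq_zero_iff] at hf
      obtain ⟨m, hm, h0⟩ := hf
      rw [map_pow, γ.eval_sig_iter] at h0
      have h1 : K.τ^[m] (γ.eval f) = 0 := eq_zero_of_pow_eq_zero h0
      rw [← iterate_map_zero K.τ m] at h1
      exact (K.τ.injective.iterate m) h1
    · intro a f hf g hg
      rw [RingHom.mem_ker, map_mul, mul_eq_zero] at hf ⊢
      refine hf.imp_left fun h => ?_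
      simp only [chi, Pt.eval_single, map_one, one_mul] at h ⊢
      rw [γ.map_smul', h]
      exact spow_zero _ _ fun h0 => hg (Subtype.ext h0)

/-- Restriction of points along `S ⊆ S'`. -/
def Pt.restrict {S S' : Semimod n} (h : S ≤ S') {K : SigmaExt k σ} (γ : Pt S' K) : Pt S K where
  toFun a := γ.toFun (Submodule.inclusion h a)
  map_zero' := by rw [map_zero]; exact γ.map_zero'
  map_add' a b := by rw [map_add]; exact γ.map_add' _ _
  map_smul' g a := by rw [map_smul]; exact γ.map_smul' _ _

lemma Pt.restrict_toSpec {S S' : Semimod n} (h : S ≤ S') {K : SigmaExt k σ} (γ : Pt S' K) :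
    (γ.restrict h).toSpec = γ.toSpec.restrict h := by
  have H : (γ.restrict h).eval.toRingHom = γ.eval.toRingHom.comp (incl k h) := by
    refine AddMonoidAlgebra.ringHom_ext (fun c => ?_) (fun a => ?_)
    · simp [incl, Pt.eval_single, Pt.restrict]
    · simp [incl, Pt.eval_single, Pt.restrict]
  have H' : ∀ f, (γ.restrict h).eval f = γ.eval (incl k h f) := fun f => RingHom.congr_fun H f
  simp only [Pt.toSpec, PSpec.restrict, PSpec.mk.injEq]
  ext f
  simp [RingHom.mem_ker, Ideal.mem_comap, H']

/-- Functoriality of points in `K`. -/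
def Pt.map {S : Semimod n} {K K' : SigmaExt k σ} (φ : K.Hom K') (γ : Pt S K) : Pt S K' where
  toFun a := φ.map (γ.toFun a)
  map_zero' := by rw [γ.map_zero', map_one]
  map_add' a b := by rw [γ.map_add', map_mul]
  map_smul' g a := by
    have h : ∀ (m : ℕ) (c : K.carrier), φ.map (K.τ^[m] c) = K'.τ^[m] (φ.map c) := by
      intro m
      induction m with
      | zero => intro c; rfl
      | succ m ih =>
        intro c
        rw [Function.iterate_succ_apply, Function.iterate_succ_apply, ih, φ.comm]
    rw [γ.map_smul', spow, spow, map_prod]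
    simp only [map_zpow₀, h]

/-- The product of two points, `(t γ)(a) = t(a) γ(a)`; for `S = S'` this is the
multiplication of `Spec^{P[σ]}(k[S])`, and for `S' = S^md` the action of its torus. -/
def Pt.act {S S' : Semimod n} (h : S ≤ S') {K : SigmaExt k σ} (t : Pt S' K) (γ : Pt S K) :
    Pt S K where
  toFun a := t.toFun (Submodule.inclusion h a) * γ.toFun a
  map_zero' := by rw [map_zero, t.map_zero', γ.map_zero', mul_one]
  map_add' a b := by rw [map_add, t.map_add', γ.map_add']; ring
  map_smul' g a := by
    rw [map_smul, t.map_smul', γ.map_smul', spow, spow, spow, ← Finset.prod_mul_distrib]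
    refine Finset.prod_congr rfl fun i _ => ?_
    rw [iterate_map_mul, mul_zpow]

end Points

/-! ### The toric variety of a fan -/

lemma le_adjoin {n : ℕ} (S : Semimod n) (a : Fin n → ℤ[X]) : S ≤ adjoin S a := le_sup_left

lemma Separates.le {n : ℕ} {S S' : Semimod n} {a : Fin n → ℤ[X]} (h : Separates S S' a) :
    S' ≤ adjoin S (-a) := h.eq ▸ le_adjoin S' a

section Variety

variable {k : Type u} [Field k] (σ : k →+* k) {n : ℕ} {ι : Type v} (S : ι → Semimod n)

/-- `p ∈ X_i` and `q ∈ X_j` are glued iff they come from one point of the common open subset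
`Spec^{P[σ]}(k[S_i + ℤ[x](-a)]) = Spec^{P[σ]}(k[S_j + ℤ[x](a)])` of `X_i` and `X_j`. -/
def Glue (p q : Σ i, PSpec σ (S i)) : Prop :=
  ∃ (a : Fin n → ℤ[X]) (h : Separates (S p.1) (S q.1) a) (r : PSpec σ (adjoin (S p.1) (-a))),
    r.restrict (le_adjoin _ _) = p.2 ∧ r.restrict h.le = q.2

/-- The topological space of `X_Σ`, glued from the `X_i = Spec^{P[σ]}(k[S_i])` (for a fan, `Glue` is
an equivalence relation). Its open sets are the sets that restrict to open sets of each `X_i`. -/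
def ToricSpace : Type (max u v) := Quot (Glue σ S)

instance : TopologicalSpace (ToricSpace σ S) :=
  inferInstanceAs (TopologicalSpace (Quot (Glue σ S)))

variable {σ} {S}

/-- The chart `X_i → X_Σ`. -/
def ToricSpace.chart (i : ι) (p : PSpec σ (S i)) : ToricSpace σ S := Quot.mk _ ⟨i, p⟩

variable (S)

/-- The gluing of the `X_i` on `K`-points. -/
def GluePt (K : SigmaExt k σ) (γ δ : Σ i, Pt (S i) K) : Prop :=
  ∃ (a : Fin n → ℤ[X]) (h : Separates (S γ.1) (S δ.1) a) (ε : Pt (adjoin (S γ.1) (-a)) K),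
    ε.restrict (le_adjoin _ _) = γ.2 ∧ ε.restrict h.le = δ.2

/-- The set `X_Σ(K)` of `K`-points of `X_Σ`. -/
def ToricPt (K : SigmaExt k σ) : Type (max u v) := Quot (GluePt S K)

variable {S}

/-- The chart `X_i(K) → X_Σ(K)`. -/
def ToricPt.chart {K : SigmaExt k σ} (i : ι) (γ : Pt (S i) K) : ToricPt S K := Quot.mk _ ⟨i, γ⟩

/-- The point of the topological space of `X_Σ` defined by a `K`-point of `X_Σ`. -/
def ToricPt.toSpace {K : SigmaExt k σ} : ToricPt S K → ToricSpace σ S :=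
  Quot.lift (fun γ => ToricSpace.chart γ.1 γ.2.toSpec) (by
    rintro ⟨i, γ⟩ ⟨j, δ⟩ ⟨a, h, ε, h1, h2⟩
    refine Quot.sound ⟨a, h, ε.toSpec, ?_, ?_⟩
    · rw [← Pt.restrict_toSpec, h1]
    · rw [← Pt.restrict_toSpec, h2])

/-- Functoriality of `X_Σ(K)` in `K`. -/
def ToricPt.map {K K' : SigmaExt k σ} (φ : K.Hom K') : ToricPt S K → ToricPt S K' :=
  Quot.map (fun γ => ⟨γ.1, γ.2.map φ⟩) (by
    rintro ⟨i, γ⟩ ⟨j, δ⟩ ⟨a, h, ε, h1, h2⟩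
    refine ⟨a, h, ε.map φ, ?_, ?_⟩
    · exact congrArg (Pt.map φ) h1
    · exact congrArg (Pt.map φ) h2)

variable (S) in
/-- The lattice `Σ^md` (all the `S_i^md` of a fan are equal to it), as a `P[x]`-semimodule. -/
def lattice : Semimod n := (⨆ i, md (S i)).restrictScalars PX

lemma le_lattice (i : ι) : S i ≤ lattice S := fun _ ha =>
  (le_iSup (fun i => md (S i)) i) (Submodule.subset_span ha)

lemma adjoin_le_lattice (i : ι) {a : Fin n → ℤ[X]} (ha : a ∈ S i) :
    adjoin (S i) (-a) ≤ lattice S := by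
  refine sup_le (le_lattice i) fun b hb => ?_
  have h : Submodule.span ℤ[X] {-a} ≤ ⨆ i, md (S i) := by
    rw [Submodule.span_le, Set.singleton_subset_iff]
    exact Submodule.neg_mem _ (le_lattice i ha)
  exact h hb

/-- The `K`-points of the torus `T_Σ = Spec^{P[σ]}(k[Σ^md])`. -/
abbrev TorusPt (S : ι → Semimod n) (K : SigmaExt k σ) : Type u := Pt (lattice S) K

/-- The action of `T_Σ(K)` on `X_Σ(K)`: on each chart, `(t γ)(a) = t(a) γ(a)`. -/
def ToricPt.act {K : SigmaExt k σ} (t : TorusPt S K) : ToricPt S K → ToricPt S K :=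
  Quot.map (fun γ => ⟨γ.1, t.act (le_lattice γ.1) γ.2⟩) (by
    rintro ⟨i, γ⟩ ⟨j, δ⟩ ⟨a, h, ε, h1, h2⟩
    refine ⟨a, h, t.act (adjoin_le_lattice i h.mem) ε, ?_, ?_⟩
    · exact congrArg (t.act (le_lattice i)) h1
    · exact congrArg (t.act (le_lattice j)) h2)

/-- `Y ⊆ X_Σ` is `T_Σ`-invariant: `T_Σ(K) · Y(K) ⊆ Y(K)` for all `σ`-field extensions `K` of `k`. -/
def IsTorusInvariant (Y : Set (ToricSpace σ S)) : Prop :=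
  ∀ (K : SigmaExt k σ) (t : TorusPt S K) (y : ToricPt S K), y.toSpace ∈ Y → (y.act t).toSpace ∈ Y

/-- `Y` is an irreducible `T_Σ`-invariant `P[σ]`-subvariety of `X_Σ`. -/
structure IsInvSubvariety (Y : Set (ToricSpace σ S)) : Prop where
  closed : IsClosed Y
  irreducible : IsIrreducible Y
  invariant : IsTorusInvariant Y

variable (σ) in
/-- The subset `D(L)` of `X_Σ`: the union over the faces `F ⊆ S_i` in the class `L` of the
subvarieties of `X_i` that are defined by the ideals `k[S_i \ F]`. -/
def FaceClass.locus (L : FaceClass S) : Set (ToricSpace σ S) :=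
  {y | ∃ A : FaceOf S, A.cls = L ∧ ∃ p : PSpec σ (S A.1),
    (∀ a : S A.1, (a : Fin n → ℤ[X]) ∉ A.2.1 → chi k a ∈ p.ideal) ∧ y = ToricSpace.chart A.1 p}

end Variety

/-! ### Isomorphisms -/

section Morphism

variable {k : Type u} [Field k] {σ : k →+* k} {n n' : ℕ} {ι : Type v} {ι' : Type w}
  {S : ι → Semimod n} {S' : ι' → Semimod n'}

/-- The `K`-points of a subvariety `Y` of `X_Σ`. -/
abbrev SubPt (Y : Set (ToricSpace σ S)) (K : SigmaExt k σ) : Type (max u v) :=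
  {y : ToricPt S K // y.toSpace ∈ Y}

/-- A morphism of `P[σ]`-varieties from `Y ⊆ X_Σ` to `Y' ⊆ X_Σ'`: a continuous map together with a
compatible morphism of functors of points that is locally given by `P[σ]`-terms. That is, near each
point of `Y ∩ X_i`, on an open subset `χ^b ≠ 0` of `Y ∩ X_i`, it maps to some `X_j`, and its
coordinates `χ^w`, `w ∈ S'_j`, are terms `c χ^s / χ^(g b)` with `c ∈ k`, `s ∈ S_i`, `g ∈ P[x]`. -/
structure VarHom (Y : Set (ToricSpace σ S)) (Y' : Set (ToricSpace σ S')) where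
  base : C(Y, Y')
  pts : ∀ K : SigmaExt k σ, SubPt Y K → SubPt Y' K
  compat : ∀ K (y : SubPt Y K), (pts K y).1.toSpace = (base ⟨y.1.toSpace, y.2⟩ : ToricSpace σ S')
  natural : ∀ (K K' : SigmaExt k σ) (φ : K.Hom K') (y : SubPt Y K) (y' : SubPt Y K'),
    y'.1 = y.1.map φ → (pts K' y').1 = (pts K y).1.map φ
  terms : ∀ (i : ι) (K : SigmaExt k σ) (γ : Pt (S i) K),
    (ToricPt.chart i γ).toSpace ∈ Y → ∃ (j : ι') (b : S i), γ.toFun b ≠ 0 ∧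
      ∃ (c : S' j → k) (s : S' j → S i) (g : S' j → PX),
        ∀ (K' : SigmaExt k σ) (γ' : Pt (S i) K') (h' : (ToricPt.chart i γ').toSpace ∈ Y),
          γ'.toFun b ≠ 0 → ∃ δ : Pt (S' j) K',
            (pts K' ⟨ToricPt.chart i γ', h'⟩).1 = ToricPt.chart j δ ∧
            ∀ w, δ.toFun w * γ'.toFun (g w • b) =
              algebraMap k K'.carrier (c w) * γ'.toFun (s w)

/-- `Y` and `Y'` are isomorphic `P[σ]`-varieties. -/
def Isomorphic (Y : Set (ToricSpace σ S)) (Y' : Set (ToricSpace σ S')) : Prop :=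
  ∃ (φ : VarHom Y Y') (ψ : VarHom Y' Y),
    (∀ y, ψ.base (φ.base y) = y) ∧ (∀ y, φ.base (ψ.base y) = y) ∧
    (∀ K y, ψ.pts K (φ.pts K y) = y) ∧ (∀ K y, φ.pts K (ψ.pts K y) = y)

end Morphism

end

end PDiff

namespace PDiff

noncomputable section

/-! ### Lattices, faces and localizations of semimodules -/

section Semimodules

variable {n : ℕ}

/-! Combinatorics. A face is recovered from its lattice, `F = S ∩ F^md`. If `u` separates `(S_i,
S_j)`, the common localization is `S_i + S_j` whatever `u` is, and `u` is a unit there, so it lies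
in every face of it. Hence `F ∼ F'` means that `F` and `F'` have the same lattice and that it
contains a separating element (`faceRel_iff`). Such an element also separates `F` from `F'`, and
condition (c) of a fan follows from (b), so each class of faces is a fan.

Gluing. The monomials that do not vanish at a point form a face `nz`. A point extends uniquely to a
semimodule whose elements are moved into `S` by adding elements of `nz`, and it extends by zero from
any face that contains `nz`. These facts hold for `K`-points and for `P[σ]`-primes alike, and all
gluing arguments use only them; `SemimodFunctor` records them once. They show that gluing is an
equivalence relation, that `D(L)` meets the chart `X_j` in `{nz ≤ F}` for the only face `F` of `S_j`
in `L`, or in nothing (`mk_mem_locus`), and that extension by zero glues to an injection `X_L → X_Σ`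
with image `D(L)`. The facts are proved for `K`-points and mostly transferred to primes, since every
`P[σ]`-prime is the vanishing ideal of a point (`PSpec.exists_pt`).

Classification. `D(L)` is closed, and it is the closure of the zero ideal of `k[F]` pulled back to
`k[S_i]`, so it is irreducible. Conversely, a closed invariant `Y` that contains a point `γ`
contains its translate by a generic torus point over `Frac K[M]`, which specializes to the generic
point of the locus of `nz γ` (`Pt.exists_act_ideal_le`). So `Y` is a union of loci; there are
finitely many, and an irreducible `Y` is one of them.

Isomorphism. `X_L → X_Σ` is a closed embedding. On charts it is extension by zero, its inverse is
restriction to `F`, and both are given by terms. -/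

lemma exists_sub_eq (p : ℤ[X]) : ∃ g h : PX, p = (g : ℤ[X]) - h := by
  rcases le_total 0 p.leadingCoeff with hp | hp
  · exact ⟨⟨p, hp⟩, 0, by simp⟩
  · exact ⟨0, ⟨-p, show 0 ≤ (-p).leadingCoeff by simpa using hp⟩, by simp⟩

lemma PX.smul_def (g : PX) (a : Fin n → ℤ[X]) : g • a = (g : ℤ[X]) • a := rfl

/-- Since `ℤ[x] = P[x] - P[x]`, the lattice consists of the differences of elements of `F`. -/
lemma mem_md_iff {F : Semimod n} {a : Fin n → ℤ[X]} : a ∈ md F ↔ ∃ b ∈ F, a + b ∈ F := by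
  constructor
  · intro ha
    induction ha using Submodule.span_induction with
    | mem x hx => exact ⟨0, F.zero_mem, by simpa using hx⟩
    | zero => exact ⟨0, F.zero_mem, by simp⟩
    | add x y _ _ hx hy =>
      obtain ⟨b, hb, hxb⟩ := hx
      obtain ⟨c, hc, hyc⟩ := hy
      exact ⟨b + c, F.add_mem hb hc, by simpa [add_add_add_comm] using F.add_mem hxb hyc⟩
    | smul p x _ hx =>
      obtain ⟨b, hb, hxb⟩ := hx
      obtain ⟨g, h, rfl⟩ := exists_sub_eq p
      refine ⟨g • b + h • (x + b), F.add_mem (F.smul_mem _ hb) (F.smul_mem _ hxb), ?_⟩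
      have : ((g : ℤ[X]) - h) • x + (g • b + h • (x + b)) = g • (x + b) + h • b := by
        simp only [PX.smul_def]; module
      rw [this]
      exact F.add_mem (F.smul_mem _ hxb) (F.smul_mem _ hb)
  · rintro ⟨b, hb, hab⟩
    simpa using (md F).sub_mem (Submodule.subset_span hab) (Submodule.subset_span hb)

lemma le_md (F : Semimod n) {a : Fin n → ℤ[X]} (ha : a ∈ F) : a ∈ md F := Submodule.subset_span ha

lemma md_smul_mem {F : Semimod n} {a : Fin n → ℤ[X]} (g : PX) (ha : a ∈ md F) : g • a ∈ md F :=
  (md F).smul_mem (g : ℤ[X]) ha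

/-- `S ∩ F^md`. -/
def infMd (S F : Semimod n) : Semimod n := S ⊓ (md F).restrictScalars PX

lemma IsFace.mem_of_mem_md {S F : Semimod n} (hF : IsFace S F) {a : Fin n → ℤ[X]} (ha : a ∈ S)
    (h : a ∈ md F) : a ∈ F := by
  obtain ⟨b, hb, hab⟩ := mem_md_iff.1 h
  exact (hF.of_add a ha b (hF.le hb) hab).1

lemma IsFace.infMd_eq {S F : Semimod n} (hF : IsFace S F) : infMd S F = F :=
  le_antisymm (fun _ ha => hF.mem_of_mem_md ha.1 ha.2) fun _ ha => ⟨hF.le ha, le_md F ha⟩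

lemma IsFace.eq_of_md_eq {S F F' : Semimod n} (hF : IsFace S F) (hF' : IsFace S F')
    (h : md F = md F') : F = F' := by
  rw [← hF.infMd_eq, ← hF'.infMd_eq, infMd, infMd, h]

/-- The sum `a + (-a) = 0` is in `F`, so every face contains all units. This is what puts separating
elements into faces. -/
lemma IsFace.mem_of_neg_mem {S F : Semimod n} (hF : IsFace S F) {a : Fin n → ℤ[X]} (ha : a ∈ S)
    (h : -a ∈ S) : a ∈ F :=
  (hF.of_add a ha (-a) h (by simp)).1

/-- Each element of `T` is moved into `S` by adding an element of `N`. -/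
def IsLoc (N S T : Semimod n) : Prop := ∀ a ∈ T, ∃ b ∈ N, a + b ∈ S

lemma IsLoc.of_le {N S T : Semimod n} (h : T ≤ S) : IsLoc N S T :=
  fun a ha => ⟨0, N.zero_mem, by simpa using h ha⟩

lemma IsLoc.sup {N S T T' : Semimod n} (h : IsLoc N S T) (h' : IsLoc N S T') :
    IsLoc N S (T ⊔ T') := by
  intro a ha
  obtain ⟨t, ht, t', ht', rfl⟩ := Submodule.mem_sup.1 ha
  obtain ⟨b, hb, hab⟩ := h t ht
  obtain ⟨c, hc, hac⟩ := h' t' ht'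
  exact ⟨b + c, N.add_mem hb hc, by simpa [add_add_add_comm] using S.add_mem hab hac⟩

/-- Shifting by elements of `F` changes neither membership in `F^md` nor the face conditions, so
these can be tested in `S`, where `S ∩ F^md = F`. -/
lemma IsFace.infMd_isFace {S F T : Semimod n} (hF : IsFace S F) (hT : IsLoc F S T) :
    IsFace T (infMd T F) := by
  refine ⟨fun _ ha => ha.1, ?_, ?_⟩
  · rintro a ha b hb ⟨_, hab⟩
    obtain ⟨c, hc, hac⟩ := hT a ha
    obtain ⟨d, hd, hbd⟩ := hT b hb
    have h : a + c + (b + d) ∈ F := by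
      refine hF.mem_of_mem_md (S.add_mem hac hbd) ?_
      rw [add_add_add_comm]
      exact (md F).add_mem hab ((md F).add_mem (le_md F hc) (le_md F hd))
    obtain ⟨h1, h2⟩ := hF.of_add _ hac _ hbd h
    exact ⟨⟨ha, mem_md_iff.2 ⟨c, hc, h1⟩⟩, ⟨hb, mem_md_iff.2 ⟨d, hd, h2⟩⟩⟩
  · rintro g hg a ha ⟨_, hga⟩
    obtain ⟨c, hc, hac⟩ := hT a ha
    refine ⟨ha, mem_md_iff.2 ⟨c, hc, hF.of_smul g hg _ hac ?_⟩⟩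
    refine hF.mem_of_mem_md (S.smul_mem g hac) ?_
    rw [smul_add]
    exact (md F).add_mem hga (md_smul_mem g (le_md F hc))

lemma md_infMd {F T : Semimod n} (h : IsLoc (infMd T F) T F) : md (infMd T F) = md F := by
  refine le_antisymm (Submodule.span_le.2 fun a ha => ha.2) (Submodule.span_le.2 fun a ha => ?_)
  obtain ⟨b, hb, hab⟩ := h a ha
  exact mem_md_iff.2 ⟨b, hb, hab, (md F).add_mem (le_md F ha) hb.2⟩

lemma md_infMd_of_le {F T : Semimod n} (h : F ≤ T) : md (infMd T F) = md F :=
  md_infMd (IsLoc.of_le h)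

/-- When a combination of generators lies in a face, so does each generator with non-zero
coefficient. Hence faces inherit finite generation, and there are finitely many of them. -/
lemma IsFace.exists_span {S F : Semimod n} (hF : IsFace S F) {s : Set (Fin n → ℤ[X])}
    (hs : Submodule.span PX s = S) : Submodule.span PX (s ∩ F) = F := by
  refine le_antisymm (Submodule.span_le.2 fun a ha => ha.2) fun a ha => ?_
  have ha' : a ∈ Submodule.span PX s := hs ▸ hF.le ha
  subst hs
  induction ha' using Submodule.span_induction with
  | mem x hx => exact Submodule.subset_span ⟨hx, ha⟩
  | zero => exact Submodule.zero_mem _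
  | add x y hx hy ihx ihy =>
    obtain ⟨h1, h2⟩ := hF.of_add x hx y hy ha
    exact Submodule.add_mem _ (ihx h1) (ihy h2)
  | smul g x hx ih =>
    by_cases hg : g = 0
    · simp [hg]
    · exact Submodule.smul_mem _ _ (ih (hF.of_smul g hg x hx ha))

lemma IsFace.fg {S F : Semimod n} (hF : IsFace S F) (hS : S.FG) : F.FG := by
  obtain ⟨s, hs⟩ := hS
  rw [← hF.exists_span hs]
  exact Submodule.fg_span (s.finite_toSet.inter_of_left _)

lemma finite_faces {S : Semimod n} (hS : S.FG) : Finite {F : Semimod n // IsFace S F} := by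
  obtain ⟨s, hs⟩ := hS
  have : Finite (Set.Iic (s : Set (Fin n → ℤ[X]))) :=
    Set.Finite.to_subtype (s.finite_toSet.finite_subsets)
  refine Finite.of_injective
    (fun F => (⟨(s : Set (Fin n → ℤ[X])) ∩ F.1, Set.inter_subset_left⟩ :
      Set.Iic (s : Set (Fin n → ℤ[X])))) fun F F' h => ?_
  have h' : (s : Set (Fin n → ℤ[X])) ∩ F.1 = (s : Set (Fin n → ℤ[X])) ∩ F'.1 :=
    congrArg Subtype.val h
  refine Subtype.ext ?_
  rw [← F.2.exists_span hs, h', F'.2.exists_span hs]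

lemma le_sup_of_span {S S' : Semimod n} {a : Fin n → ℤ[X]} (ha : a ∈ S) (ha' : -a ∈ S') :
    (Submodule.span ℤ[X] {a}).restrictScalars PX ≤ S ⊔ S' := by
  intro b hb
  obtain ⟨p, rfl⟩ := Submodule.mem_span_singleton.1 (show b ∈ Submodule.span ℤ[X] {a} from hb)
  obtain ⟨g, h, rfl⟩ := exists_sub_eq p
  have : ((g : ℤ[X]) - h) • a = g • a + h • (-a) := by simp only [PX.smul_def]; module
  rw [this]
  exact Submodule.add_mem_sup (S.smul_mem g ha) (S'.smul_mem h ha')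

lemma Separates.symm {S S' : Semimod n} {a : Fin n → ℤ[X]} (h : Separates S S' a) :
    Separates S' S (-a) :=
  ⟨h.neg_mem, by simpa using h.mem, by simpa using h.eq.symm⟩

lemma Separates.refl (S : Semimod n) : Separates S S 0 := ⟨S.zero_mem, by simp, by simp⟩

lemma adjoin_neg (S : Semimod n) (a : Fin n → ℤ[X]) : adjoin S (-a) = adjoin S a := by
  rw [adjoin, adjoin, ← Set.neg_singleton, Submodule.span_neg]

/-- This removes the choice of `a`: all separating elements define the same overlap. -/
lemma Separates.adjoin_eq {S S' : Semimod n} {a : Fin n → ℤ[X]} (h : Separates S S' a) :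
    adjoin S (-a) = S ⊔ S' := by
  refine le_antisymm ?_ (sup_le (le_adjoin _ _) h.le)
  rw [adjoin_neg]
  exact sup_le le_sup_left (le_sup_of_span h.mem h.neg_mem)

lemma Separates.isLoc {S S' : Semimod n} {a : Fin n → ℤ[X]} (h : Separates S S' a)
    {N : Semimod n} (ha : a ∈ N) : IsLoc N S (S ⊔ S') := by
  rw [← h.adjoin_eq, adjoin]
  refine (IsLoc.of_le le_rfl).sup fun b hb => ?_
  obtain ⟨p, rfl⟩ := Submodule.mem_span_singleton.1 (show b ∈ Submodule.span ℤ[X] {-a} from hb)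
  obtain ⟨g, k, rfl⟩ := exists_sub_eq p
  refine ⟨g • a, N.smul_mem g ha, ?_⟩
  have : ((g : ℤ[X]) - k) • (-a) + g • a = k • a := by simp only [PX.smul_def]; module
  rw [this]
  exact S.smul_mem k h.mem

lemma Separates.mem_face {S S' H : Semimod n} {a : Fin n → ℤ[X]} (h : Separates S S' a)
    (hH : IsFace (S ⊔ S') H) : a ∈ H :=
  hH.mem_of_neg_mem (le_sup_left (a := S) h.mem) (le_sup_right (a := S) h.neg_mem)

/-- An element of the overlap is `s + c` with `s ∈ S` and `c ∈ ℤ[x]a ⊆ F^md`, so it lies in `F^md`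
only if `s` does. Thus the overlap of two related faces is itself a face of the overlap of the
charts. -/
lemma Separates.infMd_sup {S S' F F' : Semimod n} {a : Fin n → ℤ[X]} (h : Separates S S' a)
    (hF : IsFace S F) (hF' : IsFace S' F') (hm : md F = md F') (ha : a ∈ md F) :
    infMd (S ⊔ S') F = F ⊔ F' := by
  have haF : a ∈ F := hF.mem_of_mem_md h.mem ha
  have haF' : -a ∈ F' := hF'.mem_of_mem_md h.neg_mem (hm ▸ (md F).neg_mem ha)
  apply le_antisymm
  · rintro b ⟨hb, hbm⟩
    rw [← h.adjoin_eq] at hb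
    obtain ⟨s, hs, c, hc, rfl⟩ := Submodule.mem_sup.1 hb
    have hc1 : c ∈ Submodule.span ℤ[X] {-a} := hc
    have hc2 : c ∈ md F :=
      (Submodule.span_le.2 (by simpa using ha) : Submodule.span ℤ[X] {-a} ≤ md F) hc1
    have hsF : s ∈ F := hF.mem_of_mem_md hs (by simpa using (md F).sub_mem hbm hc2)
    have hc3 : c ∈ F ⊔ F' := by
      rw [sup_comm]
      exact le_sup_of_span haF' (by simpa using haF) hc
    exact Submodule.add_mem _ (le_sup_left (a := F) hsF) hc3
  · refine sup_le (fun b hb => ⟨le_sup_left (a := S) (hF.le hb), le_md F hb⟩) fun b hb =>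
      ⟨le_sup_right (a := S) (hF'.le hb), hm ▸ le_md F' hb⟩

lemma Separates.face {S S' F F' : Semimod n} {a : Fin n → ℤ[X]} (h : Separates S S' a)
    (hF : IsFace S F) (hF' : IsFace S' F') (hm : md F = md F') (ha : a ∈ md F) :
    Separates F F' a := by
  have haF : a ∈ F := hF.mem_of_mem_md h.mem ha
  have haF' : -a ∈ F' := hF'.mem_of_mem_md h.neg_mem (hm ▸ (md F).neg_mem ha)
  have key : ∀ {S S' F F' : Semimod n} {a : Fin n → ℤ[X]}, Separates S S' a → IsFace S F →
      IsFace S' F' → md F = md F' → a ∈ F → -a ∈ F' → adjoin F (-a) = F ⊔ F' := by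
    intro S S' F F' a h hF hF' hm haF haF'
    refine le_antisymm ?_ (sup_le (le_adjoin _ _) fun b hb => ?_)
    · rw [adjoin_neg]
      exact sup_le le_sup_left (le_sup_of_span haF haF')
    · obtain ⟨s, hs, c, hc, rfl⟩ := Submodule.mem_sup.1 (h.le (hF'.le hb))
      have hc1 : c ∈ Submodule.span ℤ[X] {-a} := hc
      have hc2 : c ∈ md F :=
        (Submodule.span_le.2 (by simpa using le_md F haF) :
          Submodule.span ℤ[X] {-a} ≤ md F) hc1
      have hbm : s + c ∈ md F := hm ▸ le_md F' hb
      exact Submodule.add_mem_sup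
        (hF.mem_of_mem_md hs (by simpa using (md F).sub_mem hbm hc2)) hc
  refine ⟨haF, haF', ?_⟩
  rw [key h hF hF' hm haF haF', ← neg_neg a, key h.symm hF' hF hm.symm haF' (by simpa using haF),
    sup_comm]

end Semimodules

/-! ### Fans and classes of faces -/

section Fans

variable {n : ℕ} {ι : Type v} {S : ι → Semimod n}

lemma IsFan.separates (hS : IsFan S) (i j : ι) : ∃ a, Separates (S i) (S j) a := by
  by_cases h : i = j
  · subst h; exact ⟨0, Separates.refl _⟩
  · exact hS.pair i j h

/-- The right-hand side is symmetric in the three semimodules, which is why the triple condition of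
a fan follows from the pairwise one. -/
lemma triple_of_separates {S₁ S₂ S₃ : Semimod n} {a c : Fin n → ℤ[X]} (h₁ : Separates S₁ S₂ a)
    (h₃ : Separates S₃ S₁ c) : adjoin (adjoin S₁ (-a)) c = S₁ ⊔ S₂ ⊔ S₃ := by
  have h : adjoin S₁ c = S₁ ⊔ S₃ := by simpa using h₃.symm.adjoin_eq
  rw [h₁.adjoin_eq]
  calc adjoin (S₁ ⊔ S₂) c = adjoin S₁ c ⊔ S₂ := by rw [adjoin, adjoin, sup_right_comm]
    _ = S₁ ⊔ S₂ ⊔ S₃ := by rw [h, sup_right_comm]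

lemma IsFan.of_separates [Finite ι] [Nonempty ι] (hfg : ∀ i, (S i).FG)
    (hmd : ∃ M : Submodule ℤ[X] (Fin n → ℤ[X]), ∀ i, md (S i) = M)
    (h : ∀ i j, i ≠ j → ∃ a, Separates (S i) (S j) a) : IsFan S := by
  refine ⟨‹_›, ‹_›, hfg, hmd, h, fun i j l _ _ _ a b c ha hb hc => ?_⟩
  have h1 := triple_of_separates ha hc
  have h2 : adjoin (adjoin (S j) (-b)) a = S j ⊔ S l ⊔ S i := triple_of_separates hb ha
  have h3 : adjoin (adjoin (S l) (-c)) b = S l ⊔ S i ⊔ S j := triple_of_separates hc hb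
  have hcomm : ∀ (T : Semimod n) (x y : Fin n → ℤ[X]),
      adjoin (adjoin T x) y = adjoin (adjoin T y) x := fun T x y => by
    simp only [adjoin, sup_right_comm]
  rw [h1, hcomm (S j), h2, hcomm (S l), h3]
  constructor <;> ac_rfl

/-- The auxiliary face `H` contains the unit `a`, which gives one direction; in the other, `H` is
the intersection of the overlap with `A^md`. -/
lemma faceRel_iff {A B : FaceOf S} : FaceRel S A B ↔
    md A.2.1 = md B.2.1 ∧ ∃ a ∈ md A.2.1, Separates (S A.1) (S B.1) a := by
  constructor
  · rintro ⟨a, h, H, hH, h1, h2⟩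
    rw [h.adjoin_eq] at hH
    exact ⟨h1.trans h2.symm, a, h1 ▸ le_md H (h.mem_face hH), h⟩
  · rintro ⟨hm, a, ha, h⟩
    have haF := A.2.2.mem_of_mem_md h.mem ha
    refine ⟨a, h, infMd (adjoin (S A.1) (-a)) A.2.1, ?_, ?_, ?_⟩
    · exact A.2.2.infMd_isFace (h.adjoin_eq ▸ h.isLoc haF)
    · exact (md_infMd_of_le (A.2.2.le.trans (le_adjoin _ _))).symm
    · rw [← hm]
      exact (md_infMd_of_le (A.2.2.le.trans (le_adjoin _ _))).symm

lemma IsFan.faceRel_equivalence (hS : IsFan S) : Equivalence (FaceRel S) := by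
  refine ⟨fun A => faceRel_iff.2 ⟨rfl, 0, Submodule.zero_mem _, Separates.refl _⟩, ?_, ?_⟩
  · intro A B h
    obtain ⟨hm, a, ha, h⟩ := faceRel_iff.1 h
    exact faceRel_iff.2 ⟨hm.symm, -a, (md _).neg_mem (hm ▸ ha), h.symm⟩
  · intro A B C h h'
    obtain ⟨hm, a, ha, h⟩ := faceRel_iff.1 h
    obtain ⟨hm', b, hb, h'⟩ := faceRel_iff.1 h'
    obtain ⟨c, hc⟩ := hS.separates A.1 C.1
    refine faceRel_iff.2 ⟨hm.trans hm', c, ?_, hc⟩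
    have haB : -a ∈ B.2.1 := B.2.2.mem_of_mem_md h.neg_mem (hm ▸ (md _).neg_mem ha)
    have hbB : b ∈ B.2.1 := B.2.2.mem_of_mem_md h'.mem hb
    -- Seen from the middle chart, `B` spreads to a face of the sum of all three semimodules. There
    -- `c` is a unit, so it belongs to the lattice of `B`.
    have hface := B.2.2.infMd_isFace ((h.symm.isLoc haB).sup (h'.isLoc hbB))
    rw [hm]
    refine (hface.mem_of_neg_mem (a := c) ?_ ?_).2
    · exact le_sup_left (a := S B.1 ⊔ S A.1) (le_sup_right (a := S B.1) hc.mem)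
    · exact le_sup_right (a := S B.1 ⊔ S A.1) (le_sup_right (a := S B.1) hc.neg_mem)

lemma IsFan.cls_eq_iff (hS : IsFan S) {A B : FaceOf S} : A.cls = B.cls ↔ FaceRel S A B :=
  Quot.eq.trans hS.faceRel_equivalence.eqvGen_iff

lemma IsFan.eq_of_cls_eq (hS : IsFan S) {i : ι} {F F' : {F : Semimod n // IsFace (S i) F}}
    (h : FaceOf.cls (S := S) ⟨i, F⟩ = FaceOf.cls ⟨i, F'⟩) : F = F' :=
  Subtype.ext (F.2.eq_of_md_eq F'.2 (faceRel_iff.1 (hS.cls_eq_iff.1 h)).1)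

lemma IsFan.finite_faceOf (hS : IsFan S) : Finite (FaceOf S) := by
  have := hS.finite
  have := fun i => finite_faces (hS.affine i)
  infer_instance

lemma IsFan.family (hS : IsFan S) (L : FaceClass S) : IsFan L.family := by
  have := hS.finite_faceOf
  obtain ⟨A₀, hA₀⟩ := Quot.exists_rep L
  have : Nonempty {A : FaceOf S // A.cls = L} := ⟨⟨A₀, hA₀⟩⟩
  have rel : ∀ A B : {A : FaceOf S // A.cls = L}, FaceRel S A.1 B.1 := fun A B =>
    hS.cls_eq_iff.1 (A.2.trans B.2.symm)
  refine IsFan.of_separates (fun A => A.1.2.2.fg (hS.affine _))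
    ⟨md A₀.2.1, fun A => (faceRel_iff.1 (rel A ⟨A₀, hA₀⟩)).1⟩ fun A B _ => ?_
  obtain ⟨hm, a, ha, h⟩ := faceRel_iff.1 (rel A B)
  exact ⟨a, h.face A.1.2.2 B.1.2.2 hm ha⟩

end Fans

/-! ### Gluing along separating elements -/

/-- A presheaf on the `P[x]`-semimodules in `ℤ[x]ⁿ` whose sections `x` over `S` have a face `nz x`
of monomials that do not vanish at `x`, such that sections extend uniquely to localizations, and
by zero from faces. -/
structure SemimodFunctor (n : ℕ) where
  obj : Semimod n → Type w
  res : ∀ {S S' : Semimod n}, S ≤ S' → obj S' → obj S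
  nz : ∀ {S : Semimod n}, obj S → Semimod n
  ext : ∀ {S F : Semimod n}, IsFace S F → obj F → obj S
  res_refl : ∀ {S : Semimod n} (x : obj S), res le_rfl x = x
  res_res : ∀ {S S' S'' : Semimod n} (h : S ≤ S') (h' : S' ≤ S'') (x : obj S''),
    res h (res h' x) = res (h.trans h') x
  nz_isFace : ∀ {S : Semimod n} (x : obj S), IsFace S (nz x)
  nz_res : ∀ {S S' : Semimod n} (h : S ≤ S') (x : obj S'), nz (res h x) = S ⊓ nz x
  loc_ext : ∀ {S S' : Semimod n} (h : S ≤ S') (x y : obj S'), IsLoc (nz (res h x)) S S' →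
    res h x = res h y → x = y
  loc_exists : ∀ {S S' : Semimod n} (h : S ≤ S') (x : obj S), IsLoc (nz x) S S' →
    ∃ y, res h y = x
  res_ext : ∀ {S F : Semimod n} (hF : IsFace S F) (x : obj F), res hF.le (ext hF x) = x
  ext_res : ∀ {S F : Semimod n} (hF : IsFace S F) (x : obj S), nz x ≤ F →
    ext hF (res hF.le x) = x
  nz_ext : ∀ {S F : Semimod n} (hF : IsFace S F) (x : obj F), nz (ext hF x) ≤ F

namespace SemimodFunctor

variable {n : ℕ} (X : SemimodFunctor.{w} n) {ι : Type v} (S : ι → Semimod n)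

/-- Sections over `S i` and `S j` are glued iff they extend to the common localization. -/
def Glue (p q : Σ i, X.obj (S i)) : Prop :=
  ∃ (a : Fin n → ℤ[X]) (h : Separates (S p.1) (S q.1) a) (r : X.obj (adjoin (S p.1) (-a))),
    X.res (le_adjoin _ _) r = p.2 ∧ X.res h.le r = q.2

variable {X S}

lemma glue_iff (hS : IsFan S) {p q : Σ i, X.obj (S i)} : X.Glue S p q ↔
    ∃ r : X.obj (S p.1 ⊔ S q.1), X.res le_sup_left r = p.2 ∧ X.res le_sup_right r = q.2 := by
  constructor
  · rintro ⟨a, h, r, h1, h2⟩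
    exact ⟨X.res h.adjoin_eq.ge r, by rw [X.res_res, h1], by rw [X.res_res, h2]⟩
  · rintro ⟨r, h1, h2⟩
    obtain ⟨a, h⟩ := hS.separates p.1 q.1
    exact ⟨a, h, X.res h.adjoin_eq.le r, by rw [X.res_res, h1], by rw [X.res_res, h2]⟩

lemma mem_nz_res {T T' : Semimod n} {h : T ≤ T'} {x : X.obj T'} {a : Fin n → ℤ[X]} (ha : a ∈ T) :
    a ∈ X.nz (X.res h x) ↔ a ∈ X.nz x := by
  rw [X.nz_res]
  exact ⟨fun h => h.2, fun h => ⟨ha, h⟩⟩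

/-- A separating element is a unit on the overlap, so it cannot vanish at a section there. -/
lemma isLoc_res (hS : IsFan S) {i j : ι} (r : X.obj (S i ⊔ S j)) :
    IsLoc (X.nz (X.res le_sup_left r)) (S i) (S i ⊔ S j) := by
  obtain ⟨a, h⟩ := hS.separates i j
  exact h.isLoc ((mem_nz_res h.mem).2 (h.mem_face (X.nz_isFace r)))

lemma glue_symm (hS : IsFan S) {p q : Σ i, X.obj (S i)} (h : X.Glue S p q) : X.Glue S q p := by
  obtain ⟨r, h1, h2⟩ := (glue_iff hS).1 h
  exact (glue_iff hS).2 ⟨X.res (sup_comm _ _).le r, by rw [X.res_res, h2], by rw [X.res_res, h1]⟩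

lemma glue_equivalence (hS : IsFan S) : Equivalence (X.Glue S) := by
  refine ⟨fun p => (glue_iff hS).2 ⟨X.res (sup_idem _).le p.2, ?_, ?_⟩, glue_symm hS, ?_⟩
  · rw [X.res_res, X.res_refl]
  · rw [X.res_res, X.res_refl]
  · intro p q s h h'
    obtain ⟨r, h1, h2⟩ := (glue_iff hS).1 (glue_symm hS h)
    obtain ⟨r', h1', h2'⟩ := (glue_iff hS).1 h'
    have hr := isLoc_res hS r
    have hr' := isLoc_res hS r'
    rw [h1] at hr
    rw [h1'] at hr'
    -- Transitivity: both overlaps localize the middle chart at monomials that do not vanish at `q`,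
    -- so `q` extends to the triple sum; by uniqueness this extends `r` and `r'`.
    obtain ⟨y, hy⟩ := X.loc_exists (S := S q.1) (S' := (S q.1 ⊔ S p.1) ⊔ (S q.1 ⊔ S s.1))
      (le_sup_of_le_left le_sup_left) q.2 (hr.sup hr')
    have hyr : X.res le_sup_left y = r := by
      refine X.loc_ext (le_sup_left (a := S q.1)) _ _ ?_ ?_
      · rwa [X.res_res, hy]
      · rw [X.res_res, hy, h1]
    have hyr' : X.res le_sup_right y = r' := by
      refine X.loc_ext (le_sup_left (a := S q.1)) _ _ ?_ ?_
      · rwa [X.res_res, hy]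
      · rw [X.res_res, hy, h1']
    refine (glue_iff hS).2 ⟨X.res (sup_le_sup le_sup_right le_sup_right) y, ?_, ?_⟩
    · rw [← h2, ← hyr, X.res_res, X.res_res]
    · rw [← h2', ← hyr', X.res_res, X.res_res]

lemma mk_eq_mk_iff (hS : IsFan S) {p q : Σ i, X.obj (S i)} :
    Quot.mk (X.Glue S) p = Quot.mk (X.Glue S) q ↔ X.Glue S p q :=
  Quot.eq.trans (glue_equivalence hS).eqvGen_iff

/-- The part of the glued space that lies over the class `L` of faces. -/
def locus (X : SemimodFunctor.{w} n) (L : FaceClass S) : Set (Quot (X.Glue S)) :=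
  {y | ∃ A : FaceOf S, A.cls = L ∧ ∃ p : X.obj (S A.1), X.nz p ≤ A.2.1 ∧ y = Quot.mk _ ⟨A.1, p⟩}

/-- If a point of `X_j` is glued to one in the locus of a face `A`, then the separating element lies
in `A`, so `A` transports to the face `S_j ∩ A^md` of the same class. Membership can therefore be
read off in any chart. -/
lemma mk_mem_locus (hS : IsFan S) {L : FaceClass S} {j : ι} {p : X.obj (S j)} :
    Quot.mk _ ⟨j, p⟩ ∈ X.locus L ↔
      ∃ F : {F : Semimod n // IsFace (S j) F}, FaceOf.cls (S := S) ⟨j, F⟩ = L ∧ X.nz p ≤ F.1 := by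
  constructor
  · rintro ⟨A, hA, q, hq, h⟩
    obtain ⟨r, h1, h2⟩ := (glue_iff hS).1 ((mk_eq_mk_iff hS).1 h.symm)
    obtain ⟨a, ha⟩ := hS.separates A.1 j
    dsimp only at r h1 h2
    have har := ha.mem_face (X.nz_isFace r)
    have haF : a ∈ A.2.1 := hq (by rw [← h1]; exact (mem_nz_res ha.mem).2 har)
    have haM : -a ∈ infMd (S j) A.2.1 := ⟨ha.neg_mem, (md _).neg_mem (le_md _ haF)⟩
    have hm : md (infMd (S j) A.2.1) = md A.2.1 := by
      refine md_infMd fun b hb => ?_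
      obtain ⟨c, hc, hbc⟩ := (ha.symm.isLoc haM) b (le_sup_right (a := S j) (A.2.2.le hb))
      exact ⟨c, hc, hbc⟩
    have hloc : IsLoc A.2.1 (S A.1) (S j) := fun b hb =>
      ha.isLoc haF b (le_sup_right (a := S A.1) hb)
    have hrel : FaceRel S A ⟨j, infMd (S j) A.2.1, A.2.2.infMd_isFace hloc⟩ :=
      faceRel_iff.2 ⟨hm.symm, a, le_md _ haF, ha⟩
    refine ⟨_, (hS.cls_eq_iff.2 hrel).symm.trans hA, ?_⟩
    intro b hb
    have hbj : b ∈ S j := (X.nz_isFace p).le hb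
    rw [← h2, mem_nz_res hbj] at hb
    -- The shift `c` lies in the face and does not vanish at `r`, so `b + c` is a non-vanishing
    -- monomial of the other chart and `hq` applies to it.
    obtain ⟨c, hc, hbc⟩ := ha.isLoc (N := A.2.1 ⊓ X.nz r) ⟨haF, har⟩ b
      (le_sup_right (a := S A.1) hbj)
    refine ⟨hbj, mem_md_iff.2 ⟨c, hc.1, hq ?_⟩⟩
    rw [← h1, mem_nz_res hbc]
    exact (X.nz r).add_mem hb hc.2
  · rintro ⟨F, hF, hp⟩
    exact ⟨⟨j, F⟩, hF, p, hp, rfl⟩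

/-- A section over `F + F'` extends by zero to `S_i + S_j`, because `F + F'` is a face there. -/
lemma glue_ext (hS : IsFan S) {L : FaceClass S} {p q : Σ A, X.obj (L.family A)}
    (h : X.Glue L.family p q) :
    X.Glue S ⟨p.1.1.1, X.ext p.1.1.2.2 p.2⟩ ⟨q.1.1.1, X.ext q.1.1.2.2 q.2⟩ := by
  obtain ⟨⟨⟨i, F⟩, hA⟩, p⟩ := p
  obtain ⟨⟨⟨j, F'⟩, hB⟩, q⟩ := q
  obtain ⟨r, h1, h2⟩ := (glue_iff (hS.family L)).1 h
  obtain ⟨hm, a, ha, hs⟩ := faceRel_iff.1 (hS.cls_eq_iff.1 (hA.trans hB.symm))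
  have hH : IsFace (S i ⊔ S j) (F.1 ⊔ F'.1) := by
    rw [← hs.infMd_sup F.2 F'.2 hm ha]
    exact F.2.infMd_isFace (hs.isLoc (F.2.mem_of_mem_md hs.mem ha))
  change X.obj (F.1 ⊔ F'.1) at r
  -- Extension by zero commutes with restriction to `T` when the face `F + F'` meets `T` in `G`.
  have key : ∀ {T G : Semimod n} (hT : T ≤ S i ⊔ S j) (hG : IsFace T G) (hGH : G ≤ F.1 ⊔ F'.1),
      (∀ b ∈ T, b ∈ F.1 ⊔ F'.1 → b ∈ G) →
      X.res hT (X.ext hH r) = X.ext hG (X.res hGH r) := by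
    intro T G hT hG hGH hTG
    rw [← X.ext_res hG (X.res hT (X.ext hH r)), X.res_res]
    · congr 1
      conv_rhs => rw [← X.res_ext hH r, X.res_res]
    · intro b hb
      rw [X.nz_res] at hb
      exact hTG b hb.1 (X.nz_ext hH r hb.2)
  have hmem : ∀ b ∈ F.1 ⊔ F'.1, b ∈ md F.1 := fun b hb =>
    (hs.infMd_sup F.2 F'.2 hm ha ▸ hb : b ∈ infMd (S i ⊔ S j) F.1).2
  refine (glue_iff hS).2 ⟨X.ext hH r, ?_, ?_⟩
  · rw [key le_sup_left F.2 le_sup_left fun b hb hbF => F.2.mem_of_mem_md hb (hmem b hbF)]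
    exact congrArg _ h1
  · rw [key le_sup_right F'.2 le_sup_right fun b hb hbF =>
      F'.2.mem_of_mem_md hb (hm ▸ hmem b hbF)]
    exact congrArg _ h2

/-- Extension by zero from the glued space of the faces in a class. -/
def faceMap (X : SemimodFunctor.{w} n) (hS : IsFan S) (L : FaceClass S) :
    Quot (X.Glue L.family) → Quot (X.Glue S) :=
  Quot.map (fun p => ⟨p.1.1.1, X.ext p.1.1.2.2 p.2⟩) fun _ _ h => glue_ext hS h

lemma faceMap_injective (hS : IsFan S) (L : FaceClass S) :
    Function.Injective (X.faceMap hS L) := by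
  rintro ⟨p⟩ ⟨q⟩ h
  obtain ⟨r, h1, h2⟩ := (glue_iff hS).1 ((mk_eq_mk_iff hS).1 h)
  obtain ⟨⟨⟨i, F⟩, hA⟩, p⟩ := p
  obtain ⟨⟨⟨j, F'⟩, hB⟩, q⟩ := q
  change X.obj (S i ⊔ S j) at r
  change X.obj F.1 at p
  change X.obj F'.1 at q
  change X.res _ r = X.ext F.2 p at h1
  change X.res _ r = X.ext F'.2 q at h2
  refine Quot.sound ((glue_iff (hS.family L)).2 ⟨X.res (sup_le_sup F.2.le F'.2.le) r, ?_, ?_⟩)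
  · have : X.res le_sup_left (X.res (sup_le_sup F.2.le F'.2.le) r) = p := by
      rw [← X.res_ext F.2 p, ← h1, X.res_res, X.res_res]
    exact this
  · have : X.res le_sup_right (X.res (sup_le_sup F.2.le F'.2.le) r) = q := by
      rw [← X.res_ext F'.2 q, ← h2, X.res_res, X.res_res]
    exact this

lemma faceMap_res (hS : IsFan S) {L : FaceClass S} (A : {A : FaceOf S // A.cls = L})
    {p : X.obj (S A.1.1)} (hp : X.nz p ≤ A.1.2.1) :
    X.faceMap hS L (Quot.mk _ ⟨A, X.res A.1.2.2.le p⟩) = Quot.mk _ ⟨A.1.1, p⟩ :=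
  congrArg (fun z => Quot.mk (X.Glue S) ⟨A.1.1, z⟩) (X.ext_res A.1.2.2 p hp)

lemma range_faceMap (hS : IsFan S) (L : FaceClass S) :
    Set.range (X.faceMap hS L) = X.locus L := by
  ext y
  constructor
  · rintro ⟨⟨p⟩, rfl⟩
    exact ⟨p.1.1, p.1.2, _, X.nz_ext p.1.1.2.2 p.2, rfl⟩
  · rintro ⟨A, hA, p, hp, rfl⟩
    exact ⟨_, faceMap_res hS ⟨A, hA⟩ hp⟩

end SemimodFunctor

/-! ### Exponentiation by polynomials and construction of points -/

section Spow

variable {K : Type u} [Field K] (τ : K →+* K)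

lemma spow_eq_prod (a : K) {g : ℤ[X]} {s : Finset ℕ} (hs : g.support ⊆ s) :
    spow τ a g = ∏ i ∈ s, (τ^[i] a) ^ g.coeff i :=
  Finset.prod_subset hs fun i _ hi => by rw [notMem_support_iff.1 hi, zpow_zero]

lemma iterate_ne_zero {a : K} (ha : a ≠ 0) (i : ℕ) : τ^[i] a ≠ 0 := fun h =>
  ha (τ.injective.iterate i (h.trans (iterate_map_zero τ i).symm))

lemma spow_ne_zero {a : K} (ha : a ≠ 0) (g : ℤ[X]) : spow τ a g ≠ 0 :=
  Finset.prod_ne_zero_iff.2 fun i _ => zpow_ne_zero _ (iterate_ne_zero τ ha i)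

lemma spow_add {a : K} (ha : a ≠ 0) (g h : ℤ[X]) :
    spow τ a (g + h) = spow τ a g * spow τ a h := by
  rw [spow_eq_prod τ a (support_add (p := g) (q := h)),
    spow_eq_prod τ a (Finset.subset_union_left (s₁ := g.support) (s₂ := h.support)),
    spow_eq_prod τ a (Finset.subset_union_right (s₁ := g.support) (s₂ := h.support)),
    ← Finset.prod_mul_distrib]
  exact Finset.prod_congr rfl fun i _ => by rw [coeff_add, zpow_add₀ (iterate_ne_zero τ ha i)]

lemma spow_div (a b : K) (g : ℤ[X]) : spow τ (a / b) g = spow τ a g / spow τ b g := by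
  rw [spow, spow, spow, ← Finset.prod_div_distrib]
  exact Finset.prod_congr rfl fun i _ => by
    rw [← RingHom.coe_pow, map_div₀, div_zpow]

lemma spow_monomial (a : K) (m : ℕ) (c : ℤ) : spow τ a (monomial m c) = (τ^[m] a) ^ c := by
  rw [spow_eq_prod τ a (support_monomial_subset m c), Finset.prod_singleton, coeff_monomial_same]

end Spow

/-! ### Non-vanishing faces, extension by zero and localization of points -/

section Points

variable {k : Type u} [Field k] {σ : k →+* k} {n : ℕ} {S S' : Semimod n} {K K' : SigmaExt k σ}

/-- The element `c x^m` of `P[x]`. -/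
def monoP (m c : ℕ) : PX := ⟨monomial m (c : ℤ), show 0 ≤ (monomial m (c : ℤ)).leadingCoeff by simp⟩

/-- A multiplicative and `σ`-equivariant map whose zeros are stable under `P[x]` is a point. -/
def Pt.ofMul (f : S → K.carrier) (h0 : f 0 = 1) (hadd : ∀ a b, f (a + b) = f a * f b)
    (hx : ∀ a, f (xP • a) = K.τ (f a)) (hz : ∀ (g : PX) a, g ≠ 0 → f a = 0 → f (g • a) = 0) :
    Pt S K where
  toFun := f
  map_zero' := h0
  map_add' := hadd
  map_smul' g a := by
    -- Zeros need the separate hypothesis `hz`: elements of `P[x]` may have negative coefficients,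
    -- so additivity alone does not force `f (g • a) = 0`.
    by_cases ha : f a = 0
    · by_cases hg : g = 0
      · subst hg
        simp [h0, spow]
      · rw [hz g a hg ha, ha, spow_zero _ _ fun h => hg (Subtype.ext h)]
    have hnat : ∀ (c : ℕ) (b : S), f (c • b) = f b ^ c := fun c b => by
      induction c with
      | zero => simp [h0]
      | succ c ih => rw [succ_nsmul, hadd, ih, pow_succ]
    have hmono : ∀ m c : ℕ, f (monoP m c • a) = (K.τ^[m] (f a)) ^ c := fun m c => by
      have h1 : monoP m c = c • xP ^ m := Subtype.ext <| by
        have h2 : ((c : PX) : ℤ[X]) = c := map_natCast PX.subtype c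
        simp [monoP, xP, ← C_mul_X_pow_eq_monomial, h2]
      have h2 : ∀ m : ℕ, f (xP ^ m • a) = K.τ^[m] (f a) := fun m => by
        induction m with
        | zero => simp
        | succ m ih => rw [pow_succ', mul_smul, hx, ih, Function.iterate_succ_apply']
      rw [h1, smul_assoc, hnat, h2]
    -- The negative monomials of `p` are moved into `h`, so that only monomials with non-negative
    -- coefficients are evaluated; `f (h • a)` is cancelled at the end.
    have key : ∀ p : ℤ[X], ∃ g h : PX, (g : ℤ[X]) = p + h ∧ f (h • a) ≠ 0 ∧
        f (g • a) = spow K.τ (f a) p * f (h • a) := fun p => by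
      induction p using Polynomial.induction_on' with
      | add p q hp hq =>
        obtain ⟨g, h, h1, h2, h3⟩ := hp
        obtain ⟨g', h', h1', h2', h3'⟩ := hq
        refine ⟨g + g', h + h', ?_, ?_, ?_⟩
        · rw [Subsemiring.coe_add, Subsemiring.coe_add, h1, h1']; ring
        · rw [add_smul, hadd]; exact mul_ne_zero h2 h2'
        · rw [add_smul, hadd, add_smul, hadd, spow_add _ ha, h3, h3']; ring
      | monomial m c =>
        obtain ⟨d, rfl | rfl⟩ := c.eq_nat_or_neg
        · refine ⟨monoP m d, 0, by simp [monoP], by simp [h0], ?_⟩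
          rw [hmono, spow_monomial, zero_smul, h0, mul_one, zpow_natCast]
        · have hne : (K.τ^[m] (f a)) ^ d ≠ 0 := pow_ne_zero _ (iterate_ne_zero _ ha m)
          refine ⟨0, monoP m d, by simp [monoP], by rwa [hmono], ?_⟩
          rw [hmono, spow_monomial, zero_smul, h0, zpow_neg, zpow_natCast, inv_mul_cancel₀ hne]
    obtain ⟨g', h, h1, h2, h3⟩ := key g
    have : g' = g + h := Subtype.ext h1
    rw [this, add_smul, hadd] at h3
    exact mul_right_cancel₀ h2 h3

lemma Pt.smul_eq_zero_iff (γ : Pt S K) {g : PX} (hg : g ≠ 0) (a : S) :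
    γ.toFun (g • a) = 0 ↔ γ.toFun a = 0 := by
  rw [γ.map_smul']
  constructor
  · contrapose!
    exact fun h => spow_ne_zero _ h _
  · intro h
    rw [h, spow_zero _ _ fun h => hg (Subtype.ext h)]

/-- The face of the monomials that do not vanish at a point. -/
def Pt.nz (γ : Pt S K) : Semimod n where
  carrier := {a | ∃ h : a ∈ S, γ.toFun ⟨a, h⟩ ≠ 0}
  zero_mem' := ⟨S.zero_mem, by
    have := γ.map_zero'
    exact this.trans_ne one_ne_zero⟩
  add_mem' := by
    rintro a b ⟨ha, ha'⟩ ⟨hb, hb'⟩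
    exact ⟨S.add_mem ha hb, (γ.map_add' ⟨a, ha⟩ ⟨b, hb⟩).trans_ne (mul_ne_zero ha' hb')⟩
  smul_mem' := by
    rintro g a ⟨ha, ha'⟩
    exact ⟨S.smul_mem g ha, (γ.map_smul' g ⟨a, ha⟩).trans_ne (spow_ne_zero _ ha' _)⟩

lemma Pt.mem_nz (γ : Pt S K) (a : S) : (a : Fin n → ℤ[X]) ∈ γ.nz ↔ γ.toFun a ≠ 0 :=
  ⟨fun ⟨_, h⟩ => h, fun h => ⟨a.2, h⟩⟩

lemma Pt.nz_isFace (γ : Pt S K) : IsFace S γ.nz := by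
  refine ⟨fun _ h => h.1, ?_, ?_⟩
  · rintro a ha b hb ⟨_, h⟩
    have h' : γ.toFun ⟨a, ha⟩ * γ.toFun ⟨b, hb⟩ ≠ 0 := (γ.map_add' _ _).symm.trans_ne h
    exact ⟨⟨ha, left_ne_zero_of_mul h'⟩, ⟨hb, right_ne_zero_of_mul h'⟩⟩
  · rintro g hg a ha ⟨_, h⟩
    exact ⟨ha, fun h0 => h ((γ.smul_eq_zero_iff hg ⟨a, ha⟩).2 h0)⟩

lemma Pt.toFun_eq_zero (γ : Pt S K) (a : S) (h : (a : Fin n → ℤ[X]) ∉ γ.nz) : γ.toFun a = 0 := by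
  by_contra h0
  exact h ((γ.mem_nz a).2 h0)

lemma Pt.nz_restrict (h : S ≤ S') (γ : Pt S' K) : (γ.restrict h).nz = S ⊓ γ.nz := by
  ext a
  exact ⟨fun ⟨h1, h2⟩ => ⟨h1, h h1, h2⟩, fun ⟨h1, _, h2⟩ => ⟨h1, h2⟩⟩

open Classical in
/-- Extension of a point by zero from a face. -/
def Pt.zeroExt {F : Semimod n} (hF : IsFace S F) (γ : Pt F K) : Pt S K where
  toFun a := if h : (a : Fin n → ℤ[X]) ∈ F then γ.toFun ⟨a, h⟩ else 0
  map_zero' := by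
    rw [dif_pos (show ((0 : S) : Fin n → ℤ[X]) ∈ F from F.zero_mem)]
    exact γ.map_zero'
  map_add' a b := by
    by_cases h : (a : Fin n → ℤ[X]) ∈ F ∧ (b : Fin n → ℤ[X]) ∈ F
    · rw [dif_pos h.1, dif_pos h.2,
        dif_pos (show ((a + b : S) : Fin n → ℤ[X]) ∈ F from F.add_mem h.1 h.2), ← γ.map_add']
      rfl
    · rw [dif_neg (show ((a + b : S) : Fin n → ℤ[X]) ∉ F from
        fun h' => h (hF.of_add _ a.2 _ b.2 h'))]
      by_cases ha : (a : Fin n → ℤ[X]) ∈ F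
      · rw [dif_neg fun hb => h ⟨ha, hb⟩, mul_zero]
      · rw [dif_neg ha, zero_mul]
  map_smul' g a := by
    by_cases ha : (a : Fin n → ℤ[X]) ∈ F
    · rw [dif_pos ha, dif_pos (show ((g • a : S) : Fin n → ℤ[X]) ∈ F from F.smul_mem g ha),
        ← γ.map_smul']
      rfl
    · rw [dif_neg ha]
      by_cases hg : g = 0
      · subst hg
        rw [dif_pos (show (((0 : PX) • a : S) : Fin n → ℤ[X]) ∈ F by simp)]
        have h0 : (⟨((0 : PX) • a : S), by simp⟩ : F) = 0 := Subtype.ext (by simp)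
        rw [h0, γ.map_zero']
        simp [spow]
      · rw [dif_neg (show ((g • a : S) : Fin n → ℤ[X]) ∉ F from
            fun h => ha (hF.of_smul g hg _ a.2 h)),
          spow_zero _ _ fun h => hg (Subtype.ext h)]

lemma Pt.zeroExt_of_mem {F : Semimod n} (hF : IsFace S F) (γ : Pt F K) {a : S}
    (h : (a : Fin n → ℤ[X]) ∈ F) : (γ.zeroExt hF).toFun a = γ.toFun ⟨a, h⟩ := dif_pos h

lemma Pt.zeroExt_of_notMem {F : Semimod n} (hF : IsFace S F) (γ : Pt F K) {a : S}
    (h : (a : Fin n → ℤ[X]) ∉ F) : (γ.zeroExt hF).toFun a = 0 := dif_neg h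

lemma Pt.restrict_zeroExt {F : Semimod n} (hF : IsFace S F) (γ : Pt F K) :
    (γ.zeroExt hF).restrict hF.le = γ :=
  Pt.ext (funext fun a => Pt.zeroExt_of_mem hF γ (a := Submodule.inclusion hF.le a) a.2)

lemma Pt.zeroExt_restrict {F : Semimod n} (hF : IsFace S F) (γ : Pt S K) (h : γ.nz ≤ F) :
    (γ.restrict hF.le).zeroExt hF = γ := by
  refine Pt.ext (funext fun a => ?_)
  by_cases ha : (a : Fin n → ℤ[X]) ∈ F
  · rw [Pt.zeroExt_of_mem hF _ ha]; rfl
  · rw [Pt.zeroExt_of_notMem hF _ ha, γ.toFun_eq_zero a fun h' => ha (h h')]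

lemma Pt.nz_zeroExt {F : Semimod n} (hF : IsFace S F) (γ : Pt F K) : (γ.zeroExt hF).nz ≤ F := by
  rintro a ⟨ha, h⟩
  by_contra h'
  exact h (Pt.zeroExt_of_notMem hF γ (a := ⟨a, ha⟩) h')

lemma Pt.map_zeroExt {F : Semimod n} (hF : IsFace S F) (γ : Pt F K) (φ : K.Hom K') :
    (γ.zeroExt hF).map φ = (γ.map φ).zeroExt hF := by
  refine Pt.ext (funext fun a => ?_)
  by_cases ha : (a : Fin n → ℤ[X]) ∈ F
  · rw [Pt.zeroExt_of_mem hF _ ha]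
    exact congrArg φ.map (Pt.zeroExt_of_mem hF γ ha)
  · rw [Pt.zeroExt_of_notMem hF _ ha]
    exact (congrArg φ.map (Pt.zeroExt_of_notMem hF γ ha)).trans (map_zero _)

lemma Pt.restrict_injective (h : S ≤ S') (γ δ : Pt S' K) (hloc : IsLoc (γ.restrict h).nz S S')
    (heq : γ.restrict h = δ.restrict h) : γ = δ := by
  have hS : ∀ a (ha : a ∈ S), γ.toFun ⟨a, h ha⟩ = δ.toFun ⟨a, h ha⟩ := fun a ha =>
    congrArg (fun ε => Pt.toFun ε ⟨a, ha⟩) heq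
  refine Pt.ext (funext fun a => ?_)
  obtain ⟨b, ⟨hb, hb0⟩, hab⟩ := hloc a a.2
  have hb0' : γ.toFun ⟨b, h hb⟩ ≠ 0 := hb0
  refine mul_right_cancel₀ hb0' ?_
  have e1 := γ.map_add' a ⟨b, h hb⟩
  have e2 := δ.map_add' a ⟨b, h hb⟩
  rw [← e1, hS b hb, ← e2]
  exact hS _ hab

/-- The extension is the fraction `γ(a + b) / γ(b)` for any `b` in `nz` with `a + b ∈ S`;
cross-multiplication shows that the choice of `b` is immaterial. -/
lemma Pt.exists_restrict_eq (h : S ≤ S') (γ : Pt S K) (hloc : IsLoc γ.nz S S') :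
    ∃ δ : Pt S' K, δ.restrict h = γ := by
  choose b hb hab using hloc
  let num (a : S') : K.carrier := γ.toFun ⟨a + b a a.2, hab a a.2⟩
  let den (a : S') : K.carrier := γ.toFun ⟨b a a.2, (hb a a.2).1⟩
  have hden : ∀ a, den a ≠ 0 := fun a => (hb a a.2).2
  have hwd : ∀ (a : S') (c : Fin n → ℤ[X]) (hc : c ∈ S) (hac : (a : Fin n → ℤ[X]) + c ∈ S),
      num a * γ.toFun ⟨c, hc⟩ = γ.toFun ⟨a + c, hac⟩ * den a := fun a c hc hac => by
    simp only [num, den]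
    rw [← γ.map_add', ← γ.map_add']
    congr 1
    exact Subtype.ext (by simp only [Submodule.coe_add]; abel)
  have hval : ∀ (a : S') (c : Fin n → ℤ[X]) (hc : c ∈ γ.nz) (hac : (a : Fin n → ℤ[X]) + c ∈ S),
      num a / den a = γ.toFun ⟨a + c, hac⟩ / γ.toFun ⟨c, hc.1⟩ := fun a c hc hac => by
    rw [div_eq_div_iff (hden a) hc.2, hwd]
  have hS : ∀ a (ha : a ∈ S), num ⟨a, h ha⟩ / den ⟨a, h ha⟩ = γ.toFun ⟨a, ha⟩ := fun a ha => by
    rw [hval ⟨a, h ha⟩ 0 γ.nz.zero_mem (by simpa using ha)]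
    have h0 : γ.toFun ⟨0, S.zero_mem⟩ = 1 := γ.map_zero'
    simp [h0]
  refine ⟨⟨fun a => num a / den a, ?_, ?_, ?_⟩, Pt.ext (funext fun a => hS a a.2)⟩
  · exact (hS 0 S.zero_mem).trans γ.map_zero'
  · intro a c
    have e : ((a + c : S') : Fin n → ℤ[X]) + (b a a.2 + b c c.2) =
        (a + b a a.2) + (c + b c c.2) := by simp only [Submodule.coe_add]; abel
    rw [hval (a + c) _ (γ.nz.add_mem (hb a a.2) (hb c c.2))
      (e ▸ S.add_mem (hab a a.2) (hab c c.2)), div_mul_div_comm]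
    congr 1
    · rw [← γ.map_add']
      exact congrArg γ.toFun (Subtype.ext e)
    · exact γ.map_add' ⟨_, (hb a a.2).1⟩ ⟨_, (hb c c.2).1⟩
  · intro g a
    have e : ((g • a : S') : Fin n → ℤ[X]) + g • b a a.2 = g • (a + b a a.2) := by
      rw [smul_add]; rfl
    rw [hval (g • a) _ (γ.nz.smul_mem g (hb a a.2)) (e ▸ S.smul_mem g (hab a a.2)), spow_div]
    congr 1
    · rw [← γ.map_smul']
      exact congrArg γ.toFun (Subtype.ext e)
    · exact γ.map_smul' g ⟨_, (hb a a.2).1⟩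

/-- The functor of `K`-points. -/
def ptFunctor (K : SigmaExt k σ) (n : ℕ) : SemimodFunctor.{u} n where
  obj S := Pt S K
  res h γ := γ.restrict h
  nz γ := γ.nz
  ext hF γ := γ.zeroExt hF
  res_refl _ := rfl
  res_res _ _ _ := rfl
  nz_isFace γ := γ.nz_isFace
  nz_res h γ := γ.nz_restrict h
  loc_ext h γ δ := Pt.restrict_injective h γ δ
  loc_exists h γ := γ.exists_restrict_eq h
  res_ext hF γ := γ.restrict_zeroExt hF
  ext_res hF γ := γ.zeroExt_restrict hF
  nz_ext hF γ := γ.nz_zeroExt hF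

end Points

/-! ### Points with values in fraction fields -/

/-- The embedding into the `ℚ`-vector space `ℚ[x]ⁿ` gives unique sums, which make the algebras
`k[S]` domains. -/
instance (n : ℕ) : UniqueSums (Fin n → ℤ[X]) := by
  let f : (Fin n → ℤ[X]) →+ (Fin n → ℚ[X]) :=
    { toFun := fun a i => (a i).map (Int.castRingHom ℚ)
      map_zero' := by ext; simp
      map_add' := fun a b => by ext; simp }
  refine UniqueSums.of_injective_addHom f.toAddHom (fun a b h => funext fun i => ?_) inferInstance
  exact Polynomial.map_injective _ Int.cast_injective (congrFun h i)

instance {n : ℕ} (S : Semimod n) : UniqueSums S :=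
  UniqueSums.of_injective_addHom S.subtype.toAddMonoidHom.toAddHom Subtype.val_injective
    inferInstance

section Frac

variable {k : Type u} [Field k] {σ : k →+* k} {n : ℕ} {S S' : Semimod n}

/-- The fraction field of a domain over `k` with an injective difference operator. -/
def SigmaExt.frac (R : Type u) [CommRing R] [IsDomain R] [Algebra k R] (s : R →+* R)
    (hs : Function.Injective s) (hc : ∀ a, s (algebraMap k R a) = algebraMap k R (σ a)) :
    SigmaExt k σ where
  carrier := FractionRing R
  τ := IsFractionRing.map (K := FractionRing R) (L := FractionRing R) hs
  comm a := by
    rw [IsScalarTower.algebraMap_apply k R (FractionRing R),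
      IsScalarTower.algebraMap_apply k R (FractionRing R), IsFractionRing.map, IsLocalization.map_eq, hc]

section

variable (R : Type u) [CommRing R] [IsDomain R] [Algebra k R] (s : R →+* R)
    (hs : Function.Injective s) (hc : ∀ a, s (algebraMap k R a) = algebraMap k R (σ a))

/-- The inclusion of a domain into its fraction field. -/
def SigmaExt.toFrac : R →ₐ[k] (SigmaExt.frac R s hs hc).carrier :=
  IsScalarTower.toAlgHom k R (FractionRing R)

lemma SigmaExt.toFrac_injective : Function.Injective (SigmaExt.toFrac R s hs hc) :=
  IsFractionRing.injective R (FractionRing R)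

lemma SigmaExt.τ_toFrac (r : R) :
    (SigmaExt.frac R s hs hc).τ (SigmaExt.toFrac R s hs hc r) =
      SigmaExt.toFrac R s hs hc (s r) := by
  change IsFractionRing.map (K := FractionRing R) (L := FractionRing R) hs
    (algebraMap R (FractionRing R) r) = algebraMap R (FractionRing R) (s r)
  rw [IsFractionRing.map, IsLocalization.map_eq]

end

lemma sig_single (a : S) (c : k) :
    sig σ S (AddMonoidAlgebra.single a c) = AddMonoidAlgebra.single (xP • a) (σ c) := by
  simp [sig, AddMonoidAlgebra.mapRingHom_single]

lemma xP_ne_zero : xP ≠ 0 := fun h => X_ne_zero (R := ℤ) (congrArg Subtype.val h)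

lemma PX.smul_injective {g : PX} (hg : g ≠ 0) : Function.Injective fun a : S => g • a := by
  intro a b h
  have h' : (g : ℤ[X]) • (a : Fin n → ℤ[X]) = (g : ℤ[X]) • (b : Fin n → ℤ[X]) :=
    congrArg Subtype.val h
  have hg' : (g : ℤ[X]) ≠ 0 := fun h => hg (Subtype.ext h)
  exact Subtype.ext (funext fun i => mul_left_cancel₀ hg' (congrFun h' i))

lemma sig_injective : Function.Injective (sig σ S) := by
  refine Function.Injective.comp (g := AddMonoidAlgebra.mapRingHom S σ) ?_ ?_
  · intro f g h
    ext a
    have := congrArg (fun z => AddMonoidAlgebra.coeff z a) h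
    exact σ.injective (by simpa using this)
  · exact AddMonoidAlgebra.mapDomain_injective (PX.smul_injective xP_ne_zero)

lemma sig_algebraMap (a : k) : sig σ S (algebraMap k (AddMonoidAlgebra k S) a) =
    algebraMap k (AddMonoidAlgebra k S) (σ a) := by
  simp only [AddMonoidAlgebra.coe_algebraMap, Function.comp_apply, sig_single, smul_zero]
  rfl

/-- The point with values in `Frac R` given by a morphism `k[S] → R` of difference rings. -/
def Pt.ofHom {R : Type u} [CommRing R] [IsDomain R] [Algebra k R] (s : R →+* R)
    (hs : Function.Injective s) (hc : ∀ a, s (algebraMap k R a) = algebraMap k R (σ a))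
    (f : AddMonoidAlgebra k S →ₐ[k] R) (hf : ∀ a, f (sig σ S a) = s (f a))
    (hz : ∀ (g : PX) (a : S), g ≠ 0 → f (chi k a) = 0 → f (chi k (g • a)) = 0) :
    Pt S (SigmaExt.frac R s hs hc) :=
  Pt.ofMul (fun a => SigmaExt.toFrac R s hs hc (f (chi k a)))
    (by
      have : chi k (0 : S) = 1 := rfl
      rw [this, map_one, map_one])
    (fun a b => by
      have : chi k (a + b) = chi k a * chi k b := by
        simp [chi, AddMonoidAlgebra.single_mul_single]
      rw [this, map_mul, map_mul])
    (fun a => by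
      have : chi k (xP • a) = sig σ S (chi k a) := by rw [chi, chi, sig_single, map_one]
      rw [this, hf, SigmaExt.τ_toFrac])
    (fun g a hg h => by
      rw [hz g a hg (SigmaExt.toFrac_injective R s hs hc (h.trans (map_zero _).symm)), map_zero])

lemma Pt.eval_ofHom {R : Type u} [CommRing R] [IsDomain R] [Algebra k R] (s : R →+* R)
    (hs : Function.Injective s) (hc : ∀ a, s (algebraMap k R a) = algebraMap k R (σ a))
    (f : AddMonoidAlgebra k S →ₐ[k] R) (hf : ∀ a, f (sig σ S a) = s (f a))
    (hz : ∀ (g : PX) (a : S), g ≠ 0 → f (chi k a) = 0 → f (chi k (g • a)) = 0)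
    (x : AddMonoidAlgebra k S) :
    (Pt.ofHom s hs hc f hf hz).eval x = SigmaExt.toFrac R s hs hc (f x) := by
  suffices H : (Pt.ofHom s hs hc f hf hz).eval = (SigmaExt.toFrac R s hs hc).comp f from
    AlgHom.congr_fun H x
  refine AddMonoidAlgebra.algHom_ext (fun a => ?_) (Subsingleton.elim _ _)
  rw [Pt.eval_single, map_one, one_mul]
  rfl

lemma Pt.ideal_ofHom {R : Type u} [CommRing R] [IsDomain R] [Algebra k R] (s : R →+* R)
    (hs : Function.Injective s) (hc : ∀ a, s (algebraMap k R a) = algebraMap k R (σ a))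
    (f : AddMonoidAlgebra k S →ₐ[k] R) (hf : ∀ a, f (sig σ S a) = s (f a))
    (hz : ∀ (g : PX) (a : S), g ≠ 0 → f (chi k a) = 0 → f (chi k (g • a)) = 0) :
    (Pt.ofHom s hs hc f hf hz).toSpec.ideal = RingHom.ker f := by
  ext x
  change (Pt.ofHom s hs hc f hf hz).eval x = 0 ↔ f x = 0
  rw [Pt.eval_ofHom, map_eq_zero_iff _ (SigmaExt.toFrac_injective R s hs hc)]

@[ext]
lemma PSpec.ext {p q : PSpec σ S} (h : p.ideal = q.ideal) : p = q := by
  cases p; cases q; congr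

variable (S σ) in
/-- The zero ideal is `P[σ]`-prime. -/
lemma exists_pt_ideal_eq_bot : ∃ (K : SigmaExt k σ) (γ : Pt S K), γ.toSpec.ideal = ⊥ := by
  have : IsDomain (AddMonoidAlgebra k S) := NoZeroDivisors.to_isDomain _
  refine ⟨_, Pt.ofHom (sig σ S) sig_injective sig_algebraMap (AlgHom.id k _) (fun _ => rfl) ?_, ?_⟩
  · intro g a _ h
    exact absurd h (by simp [chi])
  · exact (Pt.ideal_ofHom _ _ _ _ _ _).trans
      ((RingHom.injective_iff_ker_eq_bot _).1 Function.injective_id)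

/-- The point takes values in the fraction field of `k[S]/p`. It allows statements about primes to
be reduced to statements about points. -/
lemma PSpec.exists_pt (p : PSpec σ S) : ∃ (K : SigmaExt k σ) (γ : Pt S K), γ.toSpec = p := by
  have := p.isPPrime.prime
  let s : AddMonoidAlgebra k S ⧸ p.ideal →+* AddMonoidAlgebra k S ⧸ p.ideal :=
    Ideal.quotientMap p.ideal (sig σ S) fun f hf => p.isPPrime.sigma f hf
  -- Perfectness with exponent `x` says that `σ(f) ∈ p` implies `f ∈ p`, so `σ` is injective on the
  -- quotient.
  have hs : Function.Injective s := Ideal.quotientMap_injective' fun f hf =>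
    p.isPPrime.perfect f X X_ne_zero (by simpa [support_X] using hf)
  have hc : ∀ a, s (algebraMap k _ a) = algebraMap k _ (σ a) := fun a =>
    congrArg (Ideal.Quotient.mk p.ideal) (sig_algebraMap a)
  refine ⟨_, Pt.ofHom s hs hc (Ideal.Quotient.mkₐ k p.ideal) (fun _ => rfl) ?_, ?_⟩
  · intro g a hg h
    have h' : chi k a ∈ p.ideal := Ideal.Quotient.eq_zero_iff_mem.1 h
    refine Ideal.Quotient.eq_zero_iff_mem.2 ?_
    simpa using p.isPPrime.monomial a 1 (by simpa using h') g hg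
  · exact PSpec.ext ((Pt.ideal_ofHom _ _ _ _ _ _).trans (Ideal.Quotient.mkₐ_ker k p.ideal))

/-! ### The functor of `P[σ]`-spectra -/

lemma Pt.chi_mem_toSpec {K : SigmaExt k σ} (γ : Pt S K) (a : S) :
    chi k a ∈ γ.toSpec.ideal ↔ γ.toFun a = 0 := by
  change γ.eval (chi k a) = 0 ↔ _
  rw [chi, γ.eval_single, map_one, one_mul]

lemma Pt.mem_nz_iff_chi {K : SigmaExt k σ} (γ : Pt S K) (a : Fin n → ℤ[X]) :
    a ∈ γ.nz ↔ ∃ h : a ∈ S, chi k (⟨a, h⟩ : S) ∉ γ.toSpec.ideal :=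
  exists_congr fun h => not_congr (γ.chi_mem_toSpec ⟨a, h⟩).symm

/-- The face of the monomials that are not in a `P[σ]`-prime ideal. -/
def PSpec.nz (p : PSpec σ S) : Semimod n where
  carrier := {a | ∃ h : a ∈ S, chi k (⟨a, h⟩ : S) ∉ p.ideal}
  zero_mem' := by
    obtain ⟨K, γ, rfl⟩ := p.exists_pt
    exact (γ.mem_nz_iff_chi 0).1 γ.nz.zero_mem
  add_mem' {a b} ha hb := by
    obtain ⟨K, γ, rfl⟩ := p.exists_pt
    exact (γ.mem_nz_iff_chi _).1
      (γ.nz.add_mem ((γ.mem_nz_iff_chi a).2 ha) ((γ.mem_nz_iff_chi b).2 hb))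
  smul_mem' g a ha := by
    obtain ⟨K, γ, rfl⟩ := p.exists_pt
    exact (γ.mem_nz_iff_chi _).1 (γ.nz.smul_mem g ((γ.mem_nz_iff_chi a).2 ha))

lemma PSpec.nz_le (p : PSpec σ S) : p.nz ≤ S := fun _ ⟨h, _⟩ => h

lemma Pt.nz_toSpec {K : SigmaExt k σ} (γ : Pt S K) : γ.toSpec.nz = γ.nz := by
  ext a
  exact (γ.mem_nz_iff_chi a).symm

lemma PSpec.nz_le_iff (p : PSpec σ S) (F : Semimod n) :
    p.nz ≤ F ↔ ∀ a : S, (a : Fin n → ℤ[X]) ∉ F → chi k a ∈ p.ideal := by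
  constructor
  · intro h a ha
    by_contra h'
    exact ha (h ⟨a.2, h'⟩)
  · rintro h a ⟨ha, h'⟩
    by_contra h''
    exact h' (h ⟨a, ha⟩ h'')

open Classical in
/-- The projection `k[S] → k[F]` onto a face, with kernel `k[S \ F]`. -/
def faceProj (k : Type u) [Field k] {F : Semimod n} (hF : IsFace S F) :
    AddMonoidAlgebra k S →ₐ[k] AddMonoidAlgebra k F :=
  AddMonoidAlgebra.lift k (AddMonoidAlgebra k F) S
    { toFun := fun a => if h : (a.toAdd : Fin n → ℤ[X]) ∈ F then
        AddMonoidAlgebra.single ⟨a.toAdd, h⟩ 1 else 0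
      map_one' := dif_pos F.zero_mem
      map_mul' := fun a b => by
        by_cases h : (a.toAdd : Fin n → ℤ[X]) ∈ F ∧ (b.toAdd : Fin n → ℤ[X]) ∈ F
        · rw [dif_pos h.1, dif_pos h.2, AddMonoidAlgebra.single_mul_single, one_mul]
          exact dif_pos (F.add_mem h.1 h.2)
        · have h0 : ¬ (((a * b).toAdd : S) : Fin n → ℤ[X]) ∈ F :=
            fun h' => h (hF.of_add _ a.toAdd.2 _ b.toAdd.2 h')
          rw [dif_neg h0]
          by_cases ha : (a.toAdd : Fin n → ℤ[X]) ∈ F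
          · rw [dif_neg fun hb => h ⟨ha, hb⟩, mul_zero]
          · rw [dif_neg ha, zero_mul] }

lemma faceProj_of_mem {F : Semimod n} (hF : IsFace S F) {a : S} (h : (a : Fin n → ℤ[X]) ∈ F)
    (c : k) : faceProj k hF (AddMonoidAlgebra.single a c) = AddMonoidAlgebra.single ⟨a, h⟩ c := by
  rw [faceProj, AddMonoidAlgebra.lift_single]
  simp [h]

lemma faceProj_of_notMem {F : Semimod n} (hF : IsFace S F) {a : S}
    (h : (a : Fin n → ℤ[X]) ∉ F) (c : k) : faceProj k hF (AddMonoidAlgebra.single a c) = 0 := by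
  rw [faceProj, AddMonoidAlgebra.lift_single]
  simp [h]

lemma Pt.eval_zeroExt {K : SigmaExt k σ} {F : Semimod n} (hF : IsFace S F) (γ : Pt F K)
    (f : AddMonoidAlgebra k S) : (γ.zeroExt hF).eval f = γ.eval (faceProj k hF f) := by
  suffices H : (γ.zeroExt hF).eval = γ.eval.comp (faceProj k hF) from AlgHom.congr_fun H f
  refine AddMonoidAlgebra.algHom_ext (fun a => ?_) (Subsingleton.elim _ _)
  rw [AlgHom.comp_apply, Pt.eval_single, map_one, one_mul]
  by_cases h : (a : Fin n → ℤ[X]) ∈ F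
  · rw [Pt.zeroExt_of_mem hF _ h, faceProj_of_mem hF h, Pt.eval_single, map_one, one_mul]
  · rw [Pt.zeroExt_of_notMem hF _ h, faceProj_of_notMem hF h, map_zero]

lemma Pt.ideal_zeroExt {K : SigmaExt k σ} {F : Semimod n} (hF : IsFace S F) (γ : Pt F K) :
    (γ.zeroExt hF).toSpec.ideal = γ.toSpec.ideal.comap (faceProj k hF) := by
  ext f
  change (γ.zeroExt hF).eval f = 0 ↔ γ.eval (faceProj k hF f) = 0
  rw [γ.eval_zeroExt]

/-- Extension by zero from the spectrum of a face: the map dual to `k[S] → k[F]`. -/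
def PSpec.zeroExt {F : Semimod n} (hF : IsFace S F) (p : PSpec σ F) : PSpec σ S where
  ideal := p.ideal.comap (faceProj k hF)
  isPPrime := by
    obtain ⟨K, γ, rfl⟩ := p.exists_pt
    rw [← γ.ideal_zeroExt hF]
    exact (γ.zeroExt hF).toSpec.isPPrime

lemma Pt.toSpec_zeroExt {K : SigmaExt k σ} {F : Semimod n} (hF : IsFace S F) (γ : Pt F K) :
    (γ.zeroExt hF).toSpec = γ.toSpec.zeroExt hF :=
  PSpec.ext (γ.ideal_zeroExt hF)

/-- Each `f` has finitely many terms, so a single monomial from `N` clears all denominators. -/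
lemma exists_chi_mul_eq_incl (h : S ≤ S') {N : Semimod n} (hN : N ≤ S) (hloc : IsLoc N S S')
    (f : AddMonoidAlgebra k S') : ∃ (b : S) (f' : AddMonoidAlgebra k S),
      (b : Fin n → ℤ[X]) ∈ N ∧ incl k h (chi k b) * f = incl k h f' := by
  have hadd : ∀ a b : S, chi k (a + b) = chi k a * chi k b := fun a b => by
    simp [chi, AddMonoidAlgebra.single_mul_single]
  induction f using AddMonoidAlgebra.induction_linear with
  | zero => exact ⟨0, 0, N.zero_mem, by simp⟩
  | add f g hf hg =>
    obtain ⟨b, f', hb, hf⟩ := hf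
    obtain ⟨c, g', hc, hg⟩ := hg
    refine ⟨b + c, chi k c * f' + chi k b * g', N.add_mem hb hc, ?_⟩
    rw [hadd, map_add, map_mul, map_mul, map_mul, ← hf, ← hg]
    ring
  | single a c =>
    obtain ⟨b, hb, hab⟩ := hloc a a.2
    refine ⟨⟨b, hN hb⟩, AddMonoidAlgebra.single ⟨a + b, hab⟩ c, hb, ?_⟩
    rw [incl_chi, chi, AddMonoidAlgebra.single_mul_single, one_mul]
    simp only [incl, AddMonoidAlgebra.mapDomainRingHom_apply, AddMonoidAlgebra.mapDomain_single]
    congr 1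
    exact Subtype.ext (add_comm _ _)

lemma PSpec.restrict_injective (h : S ≤ S') (p q : PSpec σ S')
    (hloc : IsLoc (p.restrict h).nz S S') (heq : p.restrict h = q.restrict h) : p = q := by
  have key : ∀ r : PSpec σ S', p.restrict h = r.restrict h → ∀ f (b : S)
      (f' : AddMonoidAlgebra k S), (b : Fin n → ℤ[X]) ∈ (p.restrict h).nz →
      incl k h (chi k b) * f = incl k h f' → (f ∈ r.ideal ↔ f' ∈ (p.restrict h).ideal) := by
    intro r hr f b f' hb hf
    rw [hr] at hb ⊢
    obtain ⟨_, hb⟩ := hb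
    have hb' : incl k h (chi k b) ∉ r.ideal := hb
    change _ ↔ incl k h f' ∈ r.ideal
    rw [← hf]
    exact ⟨fun hm => Ideal.mul_mem_left _ _ hm,
      fun hm => (r.isPPrime.prime.mem_or_mem hm).resolve_left hb'⟩
  refine PSpec.ext (Ideal.ext fun f => ?_)
  obtain ⟨b, f', hb, hf⟩ := exists_chi_mul_eq_incl h (p.restrict h).nz_le hloc f
  rw [key p rfl f b f' hb hf, key q heq f b f' hb hf]

/-- The functor of `P[σ]`-spectra. -/
def specFunctor (σ : k →+* k) (n : ℕ) : SemimodFunctor.{u} n where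
  obj S := PSpec σ S
  res h p := p.restrict h
  nz p := p.nz
  ext hF p := p.zeroExt hF
  res_refl p := by
    obtain ⟨K, γ, rfl⟩ := p.exists_pt
    rw [← Pt.restrict_toSpec]
    rfl
  res_res h h' p := by
    obtain ⟨K, γ, rfl⟩ := p.exists_pt
    rw [← Pt.restrict_toSpec, ← Pt.restrict_toSpec, ← Pt.restrict_toSpec]
    rfl
  nz_isFace p := by
    obtain ⟨K, γ, rfl⟩ := p.exists_pt
    rw [γ.nz_toSpec]
    exact γ.nz_isFace
  nz_res h p := by
    obtain ⟨K, γ, rfl⟩ := p.exists_pt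
    rw [← Pt.restrict_toSpec, Pt.nz_toSpec, Pt.nz_toSpec, γ.nz_restrict]
  loc_ext h p q := PSpec.restrict_injective h p q
  loc_exists h p hloc := by
    obtain ⟨K, γ, rfl⟩ := p.exists_pt
    rw [γ.nz_toSpec] at hloc
    obtain ⟨δ, rfl⟩ := γ.exists_restrict_eq h hloc
    exact ⟨δ.toSpec, (δ.restrict_toSpec h).symm⟩
  res_ext hF p := by
    obtain ⟨K, γ, rfl⟩ := p.exists_pt
    rw [← Pt.toSpec_zeroExt, ← Pt.restrict_toSpec, Pt.restrict_zeroExt]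
  ext_res hF p hp := by
    obtain ⟨K, γ, rfl⟩ := p.exists_pt
    rw [γ.nz_toSpec] at hp
    rw [← Pt.restrict_toSpec, ← Pt.toSpec_zeroExt, γ.zeroExt_restrict hF hp]
  nz_ext hF p := by
    obtain ⟨K, γ, rfl⟩ := p.exists_pt
    rw [← Pt.toSpec_zeroExt, Pt.nz_toSpec]
    exact γ.nz_zeroExt hF

end Frac

/-! ### Invariant subvarieties -/

section Topology

variable {k : Type u} [Field k] {σ : k →+* k} {n : ℕ}

/-! ### Topology of affine spectra, generic points and generic torus translates -/

section Affine

variable {S S' : Semimod n}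

lemma PSpec.specializes_of_le {p q : PSpec σ S} (h : p.ideal ≤ q.ideal) : p ⤳ q := by
  let f : PSpec σ S → PrimeSpectrum (AddMonoidAlgebra k S) :=
    fun p => ⟨p.ideal, p.isPPrime.prime⟩
  have hf : Topology.IsInducing f := ⟨rfl⟩
  exact hf.specializes_iff.1 ((PrimeSpectrum.le_iff_specializes (f p) (f q)).1 h)

lemma PSpec.isClosed_setOf_mem (s : Set (AddMonoidAlgebra k S)) :
    IsClosed {p : PSpec σ S | s ⊆ p.ideal} :=
  isClosed_induced_iff.2 ⟨_, PrimeSpectrum.isClosed_zeroLocus s, rfl⟩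

lemma PSpec.isClosed_nz_le (F : Semimod n) : IsClosed {p : PSpec σ S | p.nz ≤ F} := by
  convert PSpec.isClosed_setOf_mem (σ := σ) {f | ∃ a : S, (a : Fin n → ℤ[X]) ∉ F ∧ chi k a = f}
    using 3 with p
  rw [p.nz_le_iff]
  exact ⟨fun h f ⟨a, ha, hf⟩ => hf ▸ h a ha, fun h a ha => h ⟨a, ha, rfl⟩⟩

lemma PSpec.continuous_of_comap {T : Semimod n} {f : PSpec σ S → PSpec σ T}
    (g : AddMonoidAlgebra k T →+* AddMonoidAlgebra k S)
    (hf : ∀ p, (f p).ideal = p.ideal.comap g) : Continuous f := by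
  refine continuous_induced_rng.2 ?_
  have h : Continuous fun p : PSpec σ S =>
      PrimeSpectrum.comap g ⟨p.ideal, p.isPPrime.prime⟩ :=
    (PrimeSpectrum.continuous_comap g).comp continuous_induced_dom
  convert h using 1
  exact funext fun p => PrimeSpectrum.ext (hf p)

lemma PSpec.continuous_restrict (h : S ≤ S') :
    Continuous (PSpec.restrict h : PSpec σ S' → PSpec σ S) :=
  PSpec.continuous_of_comap (incl k h) fun _ => rfl

lemma PSpec.continuous_zeroExt {F : Semimod n} (hF : IsFace S F) :
    Continuous (PSpec.zeroExt hF : PSpec σ F → PSpec σ S) :=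
  PSpec.continuous_of_comap (faceProj k hF).toRingHom fun _ => rfl

variable (σ S) in
/-- The generic point of `Spec^{P[σ]}(k[S])`. -/
def PSpec.generic : PSpec σ S where
  ideal := ⊥
  isPPrime := by
    obtain ⟨K, γ, h⟩ := exists_pt_ideal_eq_bot σ S
    rw [← h]
    exact γ.toSpec.isPPrime

lemma incl_injective (h : S ≤ S') : Function.Injective (incl k h) :=
  AddMonoidAlgebra.mapDomain_injective (Submodule.inclusion_injective h)

lemma PSpec.restrict_generic (h : S ≤ S') :
    (PSpec.generic σ S').restrict h = PSpec.generic σ S :=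
  PSpec.ext ((RingHom.injective_iff_ker_eq_bot _).1 (incl_injective h))

lemma PSpec.nz_zeroExt_generic {F : Semimod n} (hF : IsFace S F) :
    ((PSpec.generic σ F).zeroExt hF).nz = F := by
  refine le_antisymm ((specFunctor σ n).nz_ext hF _) fun a ha => ⟨hF.le ha, fun h => ?_⟩
  have h' : faceProj k hF (chi k ⟨a, hF.le ha⟩) = 0 := h
  rw [chi, faceProj_of_mem hF (a := ⟨a, hF.le ha⟩) ha] at h'
  simp at h'

lemma PSpec.zeroExt_generic_specializes {F : Semimod n} (hF : IsFace S F) {q : PSpec σ S}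
    (hq : q.nz ≤ F) : (PSpec.generic σ F).zeroExt hF ⤳ q := by
  rw [← (specFunctor σ n).ext_res hF q hq]
  exact PSpec.specializes_of_le (Ideal.comap_mono bot_le)

lemma Pt.toSpec_map {K K' : SigmaExt k σ} (φ : K.Hom K') (γ : Pt S K) :
    (γ.map φ).toSpec = γ.toSpec := by
  have H : (γ.map φ).eval = φ.map.comp γ.eval := by
    refine AddMonoidAlgebra.algHom_ext (fun a => ?_) (Subsingleton.elim _ _)
    rw [AlgHom.comp_apply, Pt.eval_single, Pt.eval_single, map_one, one_mul, map_one, one_mul]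
    rfl
  refine PSpec.ext (Ideal.ext fun f => ?_)
  change (γ.map φ).eval f = 0 ↔ γ.eval f = 0
  rw [H, AlgHom.comp_apply, map_eq_zero φ.map]

lemma Pt.nz_act_le (h : S ≤ S') {K : SigmaExt k σ} (t : Pt S' K) (γ : Pt S K) :
    (t.act h γ).nz ≤ γ.nz :=
  fun _ ⟨ha, ha'⟩ => ⟨ha, right_ne_zero_of_mul ha'⟩

lemma coeff_faceProj {F : Semimod n} (hF : IsFace S F) (f : AddMonoidAlgebra k S) (a : F) :
    (faceProj k hF f).coeff a = f.coeff ⟨a, hF.le a.2⟩ := by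
  induction f using AddMonoidAlgebra.induction_linear with
  | zero => simp
  | add f g hf hg => simp [hf, hg]
  | single b c =>
    by_cases hb : (b : Fin n → ℤ[X]) ∈ F
    · rw [faceProj_of_mem hF hb]
      by_cases h : b = ⟨a, hF.le a.2⟩
      · subst h; simp
      · have h' : (⟨b, hb⟩ : F) ≠ a := fun h' =>
          h (Subtype.ext (congrArg (fun z : F => (z : Fin n → ℤ[X])) h'))
        simp [h, h']
    · have h : b ≠ ⟨a, hF.le a.2⟩ := fun h => hb (h ▸ a.2)
      rw [faceProj_of_notMem hF hb]
      simp [h]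

/-- Translating a point by a generic point of a torus gives the generic point of its orbit
closure. -/
lemma Pt.exists_act_ideal_le (h : S ≤ S') {K : SigmaExt k σ} (γ : Pt S K) :
    ∃ (K' : SigmaExt k σ) (φ : K.Hom K') (t : Pt S' K'),
      (t.act h (γ.map φ)).toSpec.ideal ≤ ((PSpec.generic σ γ.nz).zeroExt γ.nz_isFace).ideal := by
  -- Over `Frac K[S']` the torus has the tautological point `t(a) = χ^a`, whose values are linearly
  -- independent over `K`.
  let R := AddMonoidAlgebra K.carrier S'
  have : IsDomain R := NoZeroDivisors.to_isDomain _
  have hc : ∀ a, sig K.τ S' (algebraMap k R a) = algebraMap k R (σ a) := fun a => by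
    rw [IsScalarTower.algebraMap_apply k K.carrier R, sig_algebraMap, K.comm,
      ← IsScalarTower.algebraMap_apply]
  let K' : SigmaExt k σ := SigmaExt.frac R (sig K.τ S') sig_injective hc
  let j : R →ₐ[k] K'.carrier := SigmaExt.toFrac R (sig K.τ S') sig_injective hc
  have hj : Function.Injective j := SigmaExt.toFrac_injective R (sig K.τ S') sig_injective hc
  have hjτ : ∀ r, K'.τ (j r) = j (sig K.τ S' r) :=
    SigmaExt.τ_toFrac R (sig K.τ S') sig_injective hc
  let φ : K.Hom K' := ⟨j.comp (IsScalarTower.toAlgHom k K.carrier R), fun a => by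
    rw [AlgHom.comp_apply, AlgHom.comp_apply, hjτ]
    exact congrArg j (sig_algebraMap a).symm⟩
  let t : Pt S' K' := Pt.ofMul (fun a => j (AddMonoidAlgebra.single a 1)) (map_one j)
    (fun a b => by rw [← map_mul, AddMonoidAlgebra.single_mul_single, one_mul])
    (fun a => by rw [hjτ, sig_single, map_one])
    (fun g a _ h => by
      have h' : AddMonoidAlgebra.single a (1 : K.carrier) = 0 := hj (h.trans (map_zero j).symm)
      exact absurd (AddMonoidAlgebra.single_eq_zero.1 h') one_ne_zero)
  let θ : AddMonoidAlgebra k S →ₐ[k] R := AddMonoidAlgebra.lift k R S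
    { toFun := fun a => AddMonoidAlgebra.single (Submodule.inclusion h a.toAdd) (γ.toFun a.toAdd)
      map_one' := by
        change AddMonoidAlgebra.single (Submodule.inclusion h 0) (γ.toFun 0) = 1
        rw [map_zero, γ.map_zero']
        rfl
      map_mul' := fun a b => by
        change AddMonoidAlgebra.single (Submodule.inclusion h (a.toAdd + b.toAdd))
          (γ.toFun (a.toAdd + b.toAdd)) = _
        rw [map_add, γ.map_add', AddMonoidAlgebra.single_mul_single] }
  have hθ : ∀ a c, θ (AddMonoidAlgebra.single a c) =
      c • AddMonoidAlgebra.single (Submodule.inclusion h a) (γ.toFun a) := fun a c => by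
    simp only [θ]
    rw [AddMonoidAlgebra.lift_single]
    rfl
  have heval : (t.act h (γ.map φ)).eval = j.comp θ := by
    refine AddMonoidAlgebra.algHom_ext (fun a => ?_) (Subsingleton.elim _ _)
    rw [AlgHom.comp_apply, Pt.eval_single, map_one, one_mul, hθ, one_smul]
    change j (AddMonoidAlgebra.single (Submodule.inclusion h a) 1) *
      j (algebraMap K.carrier R (γ.toFun a)) = _
    rw [← map_mul, AddMonoidAlgebra.coe_algebraMap, Function.comp_apply,
      AddMonoidAlgebra.single_mul_single, add_zero, one_mul]
    rfl
  -- Evaluation at `tγ` keeps monomials apart and scales the one at `a` by `γ(a)`. If `f` vanishes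
  -- there, its coefficients on `nz γ` are therefore zero.
  have hcoeff : ∀ f a, (θ f).coeff (Submodule.inclusion h a) =
      algebraMap k K.carrier (f.coeff a) * γ.toFun a := fun f a => by
    induction f using AddMonoidAlgebra.induction_linear with
    | zero => simp
    | add f g hf hg =>
      have e : (θ (f + g)).coeff (Submodule.inclusion h a) =
          (θ f).coeff (Submodule.inclusion h a) + (θ g).coeff (Submodule.inclusion h a) := by
        rw [map_add]; rfl
      rw [e, hf, hg, AddMonoidAlgebra.coeff_add, Finsupp.add_apply, map_add, add_mul]
    | single b c =>
      rw [hθ]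
      by_cases hb : b = a
      · subst hb; simp [Algebra.smul_def]
      · have hb' : Submodule.inclusion h b ≠ Submodule.inclusion h a :=
          fun h' => hb (Submodule.inclusion_injective h h')
        simp [hb, hb']
  refine ⟨K', φ, t, fun f hf => ?_⟩
  have hf' : (t.act h (γ.map φ)).eval f = 0 := hf
  rw [heval, AlgHom.comp_apply, map_eq_zero_iff _ hj] at hf'
  change faceProj k γ.nz_isFace f = 0
  ext a
  obtain ⟨a, haS, ha⟩ := a
  rw [coeff_faceProj]
  have := hcoeff f ⟨a, haS⟩
  rw [hf'] at this
  simpa [ha] using this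

end Affine

/-! ### The loci of classes of faces in the glued space -/

variable {ι : Type v} {S : ι → Semimod n}

lemma ToricSpace.continuous_chart (i : ι) :
    Continuous (ToricSpace.chart i : PSpec σ (S i) → ToricSpace σ S) :=
  continuous_quot_mk.comp continuous_sigmaMk

lemma ToricSpace.isClosed_iff {Y : Set (ToricSpace σ S)} :
    IsClosed Y ↔ ∀ i, IsClosed (ToricSpace.chart i ⁻¹' Y) := by
  refine ⟨fun h i => h.preimage (ToricSpace.continuous_chart i), fun h => ?_⟩
  exact isQuotientMap_quot_mk.isClosed_preimage.1 (isClosed_sigma_iff.2 h)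

lemma FaceClass.locus_eq (L : FaceClass S) : L.locus σ = (specFunctor σ n).locus L := by
  ext y
  refine exists_congr fun A => and_congr_right fun _ => exists_congr fun p => and_congr_left
    fun _ => (p.nz_le_iff A.2.1).symm

lemma chart_mem_locus (hS : IsFan S) {L : FaceClass S} {j : ι} {p : PSpec σ (S j)} :
    ToricSpace.chart j p ∈ L.locus σ ↔
      ∃ F : {F : Semimod n // IsFace (S j) F}, FaceOf.cls (S := S) ⟨j, F⟩ = L ∧ p.nz ≤ F.1 := by
  rw [L.locus_eq]
  exact SemimodFunctor.mk_mem_locus (X := specFunctor σ n) hS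

lemma isClosed_locus (hS : IsFan S) (L : FaceClass S) : IsClosed (L.locus σ) := by
  refine ToricSpace.isClosed_iff.2 fun j => ?_
  by_cases h : ∃ F : {F : Semimod n // IsFace (S j) F}, FaceOf.cls (S := S) ⟨j, F⟩ = L
  · obtain ⟨F, hF⟩ := h
    convert PSpec.isClosed_nz_le (σ := σ) (S := S j) F.1 using 1
    ext p
    refine (chart_mem_locus hS).trans ⟨fun ⟨F', hF', hp⟩ => ?_, fun hp => ⟨F, hF, hp⟩⟩
    rwa [hS.eq_of_cls_eq (hF'.trans hF.symm)] at hp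
  · convert isClosed_empty using 1
    refine Set.eq_empty_of_forall_notMem fun p hp => h ?_
    obtain ⟨F, hF, _⟩ := (chart_mem_locus hS).1 hp
    exact ⟨F, hF⟩

variable (σ) in
/-- The generic point of the subvariety defined by a face. -/
def FaceOf.genericPoint (A : FaceOf S) : ToricSpace σ S :=
  ToricSpace.chart A.1 ((PSpec.generic σ A.2.1).zeroExt A.2.2)

/-- Both generic points are restrictions of the zero ideal of `k[A + B]`, so they are already glued
in `X_L`. -/
lemma genericPoint_eq (hS : IsFan S) {A B : FaceOf S} (h : A.cls = B.cls) :
    A.genericPoint σ = B.genericPoint σ := by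
  have hg : (specFunctor σ n).Glue (FaceClass.family B.cls)
      ⟨⟨A, h⟩, PSpec.generic σ A.2.1⟩ ⟨⟨B, rfl⟩, PSpec.generic σ B.2.1⟩ :=
    (SemimodFunctor.glue_iff (hS.family _)).2
      ⟨PSpec.generic σ (A.2.1 ⊔ B.2.1), PSpec.restrict_generic _, PSpec.restrict_generic _⟩
  exact Quot.sound (SemimodFunctor.glue_ext hS hg)

lemma locus_eq_closure (hS : IsFan S) (A : FaceOf S) :
    A.cls.locus σ = closure {A.genericPoint σ} := by
  apply subset_antisymm
  · rintro y ⟨B, hB, q, hq, rfl⟩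
    rw [← genericPoint_eq hS hB, ← specializes_iff_mem_closure]
    exact (PSpec.zeroExt_generic_specializes B.2.2 ((q.nz_le_iff _).2 hq)).map
      (ToricSpace.continuous_chart B.1)
  · refine closure_minimal (Set.singleton_subset_iff.2 ?_) (isClosed_locus hS _)
    exact (chart_mem_locus hS).2 ⟨A.2, rfl, (PSpec.nz_zeroExt_generic A.2.2).le⟩

lemma isInvSubvariety_locus (hS : IsFan S) (L : FaceClass S) : IsInvSubvariety (L.locus σ) := by
  refine ⟨isClosed_locus hS L, ?_, ?_⟩
  · obtain ⟨A, rfl⟩ := Quot.exists_rep L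
    change IsIrreducible (A.cls.locus σ)
    rw [locus_eq_closure hS A]
    exact isIrreducible_singleton.closure
  · rintro K t ⟨i, γ⟩ hy
    obtain ⟨F, hF, h⟩ := (chart_mem_locus hS (p := γ.toSpec)).1 hy
    refine (chart_mem_locus hS (p := (t.act (le_lattice i) γ).toSpec)).2 ⟨F, hF, ?_⟩
    rw [Pt.nz_toSpec] at h ⊢
    exact (Pt.nz_act_le _ t γ).trans h

/-- The generic point of one locus lies in the other, which compares faces in a fixed chart: `F ⊆ F'
⊆ F''` with `F` and `F''` in the same class, hence equal. -/
lemma locus_injective (hS : IsFan S) :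
    Function.Injective (FaceClass.locus (S := S) σ) := by
  intro L L' h
  obtain ⟨A, rfl⟩ := Quot.exists_rep L
  have key : ∀ {L L' : FaceClass S}, L.locus σ = L'.locus σ → ∀ {i : ι}
      (F : {F : Semimod n // IsFace (S i) F}), FaceOf.cls (S := S) ⟨i, F⟩ = L →
      ∃ F' : {F : Semimod n // IsFace (S i) F}, FaceOf.cls (S := S) ⟨i, F'⟩ = L' ∧
        F.1 ≤ F'.1 := by
    intro L L' h i F hF
    have hm : ToricSpace.chart i ((PSpec.generic σ F.1).zeroExt F.2) ∈ L.locus σ :=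
      (chart_mem_locus hS).2 ⟨F, hF, (PSpec.nz_zeroExt_generic F.2).le⟩
    rw [h, chart_mem_locus hS, PSpec.nz_zeroExt_generic] at hm
    exact hm
  obtain ⟨F', h1, h2⟩ := key h A.2 rfl
  obtain ⟨F'', h3, h4⟩ := key h.symm F' h1
  obtain rfl : F'' = A.2 := hS.eq_of_cls_eq h3
  obtain rfl : F' = A.2 := Subtype.ext (le_antisymm h4 h2)
  exact h1

/-- `Y` contains a generic translate of `γ`, and this specializes to the generic point of the locus.
-/
lemma locus_subset (hS : IsFan S) {Y : Set (ToricSpace σ S)} (hY : IsInvSubvariety Y) {i : ι}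
    {K : SigmaExt k σ} (γ : Pt (S i) K) (h : ToricSpace.chart i γ.toSpec ∈ Y) :
    (FaceOf.cls (S := S) ⟨i, γ.nz, γ.nz_isFace⟩).locus σ ⊆ Y := by
  obtain ⟨K', φ, t, ht⟩ := γ.exists_act_ideal_le (le_lattice i)
  rw [← γ.toSpec_map φ] at h
  have h' : ToricSpace.chart i (t.act (le_lattice i) (γ.map φ)).toSpec ∈ Y :=
    hY.invariant K' t (ToricPt.chart i (γ.map φ)) h
  rw [locus_eq_closure hS]
  refine closure_minimal (Set.singleton_subset_iff.2 ?_) hY.closed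
  exact ((PSpec.specializes_of_le ht).map (ToricSpace.continuous_chart i)).mem_closed hY.closed h'

lemma exists_locus_eq (hS : IsFan S) {Y : Set (ToricSpace σ S)} (hY : IsInvSubvariety Y) :
    ∃ L : FaceClass S, L.locus σ = Y := by
  have := hS.finite_faceOf
  have : Finite (FaceClass S) := inferInstanceAs (Finite (Quot _))
  have hfin : {Z | ∃ L : FaceClass S, L.locus σ = Z ∧ Z ⊆ Y}.Finite :=
    (Set.finite_range (FaceClass.locus (S := S) σ)).subset fun Z ⟨L, hL, _⟩ => ⟨L, hL⟩
  -- The finitely many loci contained in `Y` cover it, since each of its points lies in the locus of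
  -- its own `nz`; irreducibility selects one of them.
  obtain ⟨Z, hZ, hYZ⟩ := isIrreducible_iff_sUnion_isClosed.1 hY.irreducible hfin.toFinset
    (fun Z hZ => by
      obtain ⟨L, rfl, _⟩ := hfin.mem_toFinset.1 hZ
      exact isClosed_locus hS L)
    (by
      rintro ⟨i, p⟩ hy
      obtain ⟨K, γ, rfl⟩ := p.exists_pt
      refine ⟨_, hfin.mem_toFinset.2 ⟨_, rfl, locus_subset hS hY γ hy⟩, ?_⟩
      exact (chart_mem_locus hS (p := γ.toSpec)).2
        ⟨⟨γ.nz, γ.nz_isFace⟩, rfl, γ.nz_toSpec.le⟩)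
  obtain ⟨L, rfl, hLY⟩ := hfin.mem_toFinset.1 hZ
  exact ⟨L, hLY.antisymm hYZ⟩

variable (σ) in
/-- The bijection between classes of faces and irreducible invariant subvarieties. -/
def locusEquiv (hS : IsFan S) :
    FaceClass S ≃ {Y : Set (ToricSpace σ S) // IsInvSubvariety Y} :=
  Equiv.ofBijective (fun L => ⟨L.locus σ, isInvSubvariety_locus hS L⟩)
    ⟨fun _ _ h => locus_injective hS (congrArg Subtype.val h),
      fun Y => let ⟨L, hL⟩ := exists_locus_eq hS Y.2; ⟨L, Subtype.ext hL⟩⟩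

/-! ### The subvariety of a class as a toric variety -/

variable (σ) in
/-- The map `X_L → X_Σ` that extends by zero on each chart. -/
def spaceMap (hS : IsFan S) (L : FaceClass S) : ToricSpace σ L.family → ToricSpace σ S :=
  (specFunctor σ n).faceMap hS L

/-- The map `X_L(K) → X_Σ(K)` that extends by zero on each chart. -/
def ptMap (hS : IsFan S) (L : FaceClass S) (K : SigmaExt k σ) :
    ToricPt L.family K → ToricPt S K :=
  (ptFunctor K n).faceMap hS L

lemma spaceMap_restrict (hS : IsFan S) {L : FaceClass S} (A : {A : FaceOf S // A.cls = L})
    {p : PSpec σ (S A.1.1)} (hp : p.nz ≤ A.1.2.1) :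
    spaceMap σ hS L (ToricSpace.chart A (p.restrict A.1.2.2.le)) = ToricSpace.chart A.1.1 p :=
  SemimodFunctor.faceMap_res (X := specFunctor σ n) hS A hp

lemma ptMap_restrict (hS : IsFan S) {L : FaceClass S} {K : SigmaExt k σ}
    (A : {A : FaceOf S // A.cls = L}) {γ : Pt (S A.1.1) K} (h : γ.nz ≤ A.1.2.1) :
    ptMap hS L K (ToricPt.chart A (γ.restrict A.1.2.2.le)) = ToricPt.chart A.1.1 γ :=
  SemimodFunctor.faceMap_res (X := ptFunctor K n) hS A h

lemma spaceMap_injective (hS : IsFan S) (L : FaceClass S) :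
    Function.Injective (spaceMap σ hS L) :=
  SemimodFunctor.faceMap_injective hS L

lemma ptMap_injective (hS : IsFan S) (L : FaceClass S) (K : SigmaExt k σ) :
    Function.Injective (ptMap hS L K) :=
  SemimodFunctor.faceMap_injective hS L

lemma range_spaceMap (hS : IsFan S) (L : FaceClass S) :
    Set.range (spaceMap σ hS L) = L.locus σ := by
  rw [L.locus_eq]
  exact SemimodFunctor.range_faceMap (X := specFunctor σ n) hS L

lemma toSpace_ptMap (hS : IsFan S) (L : FaceClass S) {K : SigmaExt k σ}
    (y : ToricPt L.family K) : (ptMap hS L K y).toSpace = spaceMap σ hS L y.toSpace := by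
  obtain ⟨A, γ⟩ := y
  exact congrArg (ToricSpace.chart A.1.1) (Pt.toSpec_zeroExt A.1.2.2 γ)

lemma ptMap_map (hS : IsFan S) (L : FaceClass S) {K K' : SigmaExt k σ} (φ : K.Hom K')
    (y : ToricPt L.family K) : ptMap hS L K' (y.map φ) = (ptMap hS L K y).map φ := by
  obtain ⟨A, γ⟩ := y
  exact congrArg (ToricPt.chart A.1.1) (Pt.map_zeroExt A.1.2.2 γ φ).symm

lemma chart_pt_mem_locus (hS : IsFan S) {L : FaceClass S} {K : SigmaExt k σ} {i : ι}
    {γ : Pt (S i) K} : (ToricPt.chart i γ : ToricPt S K).toSpace ∈ L.locus σ ↔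
      ∃ F : {F : Semimod n // IsFace (S i) F}, FaceOf.cls (S := S) ⟨i, F⟩ = L ∧ γ.nz ≤ F.1 := by
  rw [← γ.nz_toSpec]
  exact chart_mem_locus hS (p := γ.toSpec)

lemma exists_ptMap_eq (hS : IsFan S) {L : FaceClass S} {K : SigmaExt k σ} {y : ToricPt S K}
    (hy : y.toSpace ∈ L.locus σ) : ∃ x, ptMap hS L K x = y := by
  obtain ⟨i, γ⟩ := y
  obtain ⟨F, hF, h⟩ := (chart_pt_mem_locus hS).1 hy
  exact ⟨_, ptMap_restrict hS ⟨⟨i, F⟩, hF⟩ h⟩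

lemma continuous_spaceMap (hS : IsFan S) (L : FaceClass S) : Continuous (spaceMap σ hS L) := by
  refine (isQuotientMap_quot_mk (r := Glue σ L.family)).continuous_iff.2
    (continuous_sigma fun A => ?_)
  exact (ToricSpace.continuous_chart A.1.1).comp (PSpec.continuous_zeroExt A.1.2.2)

/-- In a chart with a face `F` in `L`, the image of `C` is cut out of the closed set `{nz ≤ F}` by a
closed condition on the restriction to `F`; in the other charts it is empty. -/
lemma isClosedMap_spaceMap (hS : IsFan S) (L : FaceClass S) : IsClosedMap (spaceMap σ hS L) := by
  intro C hC
  refine ToricSpace.isClosed_iff.2 fun j => ?_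
  by_cases h : ∃ F : {F : Semimod n // IsFace (S j) F}, FaceOf.cls (S := S) ⟨j, F⟩ = L
  · obtain ⟨F, hF⟩ := h
    let A : {A : FaceOf S // A.cls = L} := ⟨⟨j, F⟩, hF⟩
    have hcl := (PSpec.isClosed_nz_le (σ := σ) (S := S j) F.1).inter
      ((ToricSpace.isClosed_iff.1 hC A).preimage (PSpec.continuous_restrict F.2.le))
    convert hcl using 1
    ext p
    constructor
    · rintro ⟨y, hy, hyp⟩
      have hp : ToricSpace.chart j p ∈ L.locus σ := by
        rw [← range_spaceMap hS L, ← hyp]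
        exact ⟨y, rfl⟩
      obtain ⟨F', hF', hp⟩ := (chart_mem_locus hS).1 hp
      rw [hS.eq_of_cls_eq (hF'.trans hF.symm)] at hp
      refine ⟨hp, ?_⟩
      have := spaceMap_injective hS L (hyp.trans (spaceMap_restrict hS A hp).symm)
      rw [this] at hy
      exact hy
    · rintro ⟨hp, hC⟩
      exact ⟨_, hC, spaceMap_restrict hS A hp⟩
  · convert isClosed_empty using 1
    refine Set.eq_empty_of_forall_notMem ?_
    rintro p ⟨y, _, hyp⟩
    have hp : ToricSpace.chart j p ∈ L.locus σ := by
      rw [← range_spaceMap hS L, ← hyp]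
      exact ⟨y, rfl⟩
    obtain ⟨F, hF, _⟩ := (chart_mem_locus hS).1 hp
    exact h ⟨F, hF⟩

variable (σ) in
/-- The homeomorphism `X_L ≃ D(L)`. -/
def spaceHomeo (hS : IsFan S) (L : FaceClass S) :
    (Set.univ : Set (ToricSpace σ L.family)) ≃ₜ L.locus σ :=
  (Homeomorph.Set.univ _).trans <|
    ((Topology.IsClosedEmbedding.of_continuous_injective_isClosedMap (continuous_spaceMap hS L)
      (spaceMap_injective hS L) (isClosedMap_spaceMap hS L)).toHomeomorph).trans
    (Homeomorph.setCongr (range_spaceMap hS L))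

/-- The bijection `X_L(K) ≃ D(L)(K)`. -/
def ptEquiv (hS : IsFan S) (L : FaceClass S) (K : SigmaExt k σ) :
    SubPt (Set.univ : Set (ToricSpace σ L.family)) K ≃ SubPt (L.locus σ) K :=
  Equiv.ofBijective
    (fun y => ⟨ptMap hS L K y.1, by
      rw [toSpace_ptMap, ← range_spaceMap hS L]
      exact ⟨_, rfl⟩⟩)
    ⟨fun _ _ h => Subtype.ext (ptMap_injective hS L K (congrArg Subtype.val h)),
      fun y => let ⟨x, hx⟩ := exists_ptMap_eq hS y.2; ⟨⟨x, trivial⟩, Subtype.ext hx⟩⟩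

lemma coe_ptEquiv (hS : IsFan S) (L : FaceClass S) {K : SigmaExt k σ}
    (y : SubPt (Set.univ : Set (ToricSpace σ L.family)) K) :
    (ptEquiv hS L K y).1 = ptMap hS L K y.1 := rfl

open Classical in
lemma Pt.zeroExt_eq_mul {K : SigmaExt k σ} {T F : Semimod n} (hF : IsFace T F) (γ : Pt F K)
    (w : T) : (γ.zeroExt hF).toFun w =
      algebraMap k K.carrier (if (w : Fin n → ℤ[X]) ∈ F then 1 else 0) *
        γ.toFun (if h : (w : Fin n → ℤ[X]) ∈ F then ⟨w, h⟩ else 0) := by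
  by_cases h : (w : Fin n → ℤ[X]) ∈ F
  · rw [if_pos h, dif_pos h, map_one, one_mul, Pt.zeroExt_of_mem hF γ h]
  · rw [if_neg h, map_zero, zero_mul, Pt.zeroExt_of_notMem hF γ h]

open Classical in
variable (σ) in
/-- The morphism `X_L → D(L)`. -/
def fromFamily (hS : IsFan S) (L : FaceClass S) :
    VarHom (Set.univ : Set (ToricSpace σ L.family)) (L.locus σ) where
  base := ⟨spaceHomeo σ hS L, (spaceHomeo σ hS L).continuous⟩
  pts K := ptEquiv hS L K
  compat K y := toSpace_ptMap hS L y.1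
  natural K K' φ y y' h := by
    rw [coe_ptEquiv, coe_ptEquiv, h, ptMap_map]
  terms A K γ _ := by
    -- With `b = 0` the open set is the whole chart. Off the face the coefficient is `0`, so the
    -- exponent there is an arbitrary default.
    refine ⟨A.1.1, 0, ?_, fun w => if (w : Fin n → ℤ[X]) ∈ A.1.2.1 then 1 else 0,
      fun w => if h : (w : Fin n → ℤ[X]) ∈ A.1.2.1 then ⟨w, h⟩ else 0, fun _ => 0,
      fun K' γ' h' _ => ⟨γ'.zeroExt A.1.2.2, rfl, fun w => ?_⟩⟩
    · rw [γ.map_zero']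
      exact one_ne_zero
    · rw [smul_zero, γ'.map_zero', mul_one]
      exact Pt.zeroExt_eq_mul A.1.2.2 γ' w

variable (σ) in
/-- The morphism `D(L) → X_L`. -/
def toFamily (hS : IsFan S) (L : FaceClass S) :
    VarHom (L.locus σ) (Set.univ : Set (ToricSpace σ L.family)) where
  base := ⟨(spaceHomeo σ hS L).symm, (spaceHomeo σ hS L).symm.continuous⟩
  pts K := (ptEquiv hS L K).symm
  compat K y := by
    obtain ⟨x, rfl⟩ := (ptEquiv hS L K).surjective y
    rw [Equiv.symm_apply_apply]
    have : (⟨(ptEquiv hS L K x).1.toSpace, (ptEquiv hS L K x).2⟩ : L.locus σ) =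
        spaceHomeo σ hS L ⟨x.1.toSpace, trivial⟩ := Subtype.ext (toSpace_ptMap hS L x.1)
    rw [this]
    exact congrArg Subtype.val ((spaceHomeo σ hS L).symm_apply_apply ⟨x.1.toSpace, trivial⟩).symm
  natural K K' φ y y' h := by
    obtain ⟨x, rfl⟩ := (ptEquiv hS L K).surjective y
    obtain ⟨x', rfl⟩ := (ptEquiv hS L K').surjective y'
    rw [Equiv.symm_apply_apply, Equiv.symm_apply_apply]
    rw [coe_ptEquiv, coe_ptEquiv, ← ptMap_map] at h
    exact ptMap_injective hS L K' h
  terms i K γ h := by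
    obtain ⟨F, hF, _⟩ := (chart_pt_mem_locus hS).1 h
    refine ⟨⟨⟨i, F⟩, hF⟩, 0, ?_, fun _ => 1, fun w => ⟨w, F.2.le w.2⟩, fun _ => 0,
      fun K' γ' h' _ => ⟨γ'.restrict F.2.le, ?_, fun w => ?_⟩⟩
    · rw [γ.map_zero']
      exact one_ne_zero
    -- `F` was chosen from `γ`, but a class has at most one face in each chart, so it also serves
    -- for `γ'`.
    · obtain ⟨F', hF', hγ'⟩ := (chart_pt_mem_locus hS).1 h'
      rw [hS.eq_of_cls_eq (hF'.trans hF.symm)] at hγ'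
      refine ptMap_injective hS L K' ?_
      rw [← coe_ptEquiv, Equiv.apply_symm_apply]
      exact (ptMap_restrict hS ⟨⟨i, F⟩, hF⟩ hγ').symm
    · rw [smul_zero, γ'.map_zero', mul_one, map_one, one_mul]
      rfl

lemma isomorphic_family (hS : IsFan S) (L : FaceClass S) :
    Isomorphic (L.locus σ) (Set.univ : Set (ToricSpace σ L.family)) :=
  ⟨toFamily σ hS L, fromFamily σ hS L, fun y => (spaceHomeo σ hS L).apply_symm_apply y,
    fun y => (spaceHomeo σ hS L).symm_apply_apply y,
    fun K y => (ptEquiv hS L K).apply_symm_apply y,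
    fun K y => (ptEquiv hS L K).symm_apply_apply y⟩

end Topology

end

end PDiff

theorem mainTheorem3 {k : Type u} [Field k] [CharZero k] (σ : k →+* k) {n : ℕ} {ι : Type v}
    (S : ι → PDiff.Semimod n) (hS : PDiff.IsFan S) :
    ∃ D : PDiff.FaceClass S ≃ {Y : Set (PDiff.ToricSpace σ S) // PDiff.IsInvSubvariety Y},
      ∀ L : PDiff.FaceClass S,
        (D L : Set (PDiff.ToricSpace σ S)) = L.locus σ ∧
        PDiff.IsFan L.family ∧
        PDiff.Isomorphic (D L : Set (PDiff.ToricSpace σ S))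
          (Set.univ : Set (PDiff.ToricSpace σ L.family)) :=
  ⟨PDiff.locusEquiv σ hS, fun L => ⟨rfl, hS.family L, PDiff.isomorphic_family hS L⟩⟩
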